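/- Let $n\ge 6$ and let $C\in\mathbb{Z}[X_1,\dots,X_n]$ be a cubic form that is non-singular over $\mathbb{C}$. Put $f(x_1,\dots,x_{n+1})=C(x_1,\dots,x_n)-x_{n+1}^2$, and for $\mathbf m\in\mathbb{Z}^{n+1}$ and $k\ge 1$ let $$Q(\mathbf m,k)=\sum_{\substack{h \bmod k\\ (h,k)=1}}\ \sum_{\mathbf l\in(\mathbb{Z}/k\mathbb{Z})^{n+1}} e^{2\pi i (h f(\mathbf l)+\mathbf m\cdot\mathbf l)/k}.$$ Let $F_1\in\mathbb{Z}[X_1,\dots,X_n]$ be a defining polynomial of the dual variety of the hypersurface $C=0$, that is, $F_1$ is irreducible over $\mathbb{Q}$ and its zero set in $\mathbb{C}^n$ is the affine cone over the dual variety. Let $F_2\in\mathbb{Z}[X_1,\dots,X_n]$ be any polynomial that is not a multiple of $F_1$ in $\mathbb{Q}[X_1,\dots,X_n]$. For $\hat{\mathbf m}\in\mathbb{Z}^n$ write $(\hat{\mathbf m},0)=(m_1,\dots,m_n,0)$ and $\|\hat{\mathbf m}\|=\max_i|m_i|$. Let $k_3,l_4$ be positive integers such that $k_3l_4$ is cube-full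 (every prime dividing it does so to at least the third power) and $k_3=\prod_{p^3\| k_3l_4}p^3$. Then for every $\varepsilon>0$ and every real $y\ge 0$, $$\sum_{\substack{\|\hat{\mathbf m}\|\le y\\ F_1(\hat{\mathbf m})=0}}|Q((\hat{\mathbf m},0),k_3l_4)|\ll (k_3l_4)^{\varepsilon}\Bigl(k_3^{\frac56 n+\frac43}\,l_4^{\,n+1}+y^{n-1}(k_3l_4)^{\frac12 n+\frac53}\Bigr)$$ and $$\sum_{\substack{\|\hat{\mathbf m}\|\le y\\ F_1(\hat{\mathbf m})=F_2(\hat{\mathbf m})=0}}|Q((\hat{\mathbf m},0),k_3l_4)|\ll (k_3l_4)^{\varepsilon}\Bigl(k_3^{\frac56 n+\frac43}\,l_4^{\,n+1}+y^{n-2}(k_3l_4)^{\frac12 n+2}\Bigr).$$ The implied constants depend only on $n$, $C$, $F_1$, $\varepsilon$ and, in the second estimate, on $F_2$; in particular they do not depend on $k_3$, $l_4$ or $y$. -/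

import Mathlib

open MvPolynomial

/-- A form `C ∈ ℤ[X₁, …, Xₙ]` is non-singular (over `ℂ`): its partial derivatives have no common
zero in `ℂⁿ` other than the origin. -/
def NonsingularForm {n : ℕ} (C : MvPolynomial (Fin n) ℤ) : Prop :=
  ∀ x : Fin n → ℂ, (∀ i, aeval x (pderiv i C) = 0) → x = 0

/-- The affine cone in `ℂⁿ` over the dual variety of the projective hypersurface `C = 0`: the
coefficient vectors `m` that are multiples of the gradient of `C` at some (nonzero) point of the
hypersurface.  (For non-singular `C` the Gauss map is everywhere defined on the hypersurface, so
that its image is closed and no Zariski closure has to be taken.) -/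
def dualCone {n : ℕ} (C : MvPolynomial (Fin n) ℤ) : Set (Fin n → ℂ) :=
  {m | ∃ x : Fin n → ℂ, x ≠ 0 ∧ aeval x C = 0 ∧
    ∃ c : ℂ, ∀ i, m i = c * aeval x (pderiv i C)}

/-- `F ∈ ℤ[X₁, …, Xₙ]` is a defining polynomial of the dual variety of `C = 0`: it is irreducible
over `ℚ`, and its complex zeros are the points of the cone over the dual variety.  These
conditions determine `F` up to a nonzero rational factor. -/
def IsDualForm {n : ℕ} (C F : MvPolynomial (Fin n) ℤ) : Prop :=
  Irreducible (map (Int.castRingHom ℚ) F) ∧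
    ∀ m : Fin n → ℂ, aeval m F = 0 ↔ m ∈ dualCone C

/-- The polynomial `f(x₁, …, xₙ₊₁) = C(x₁, …, xₙ) - xₙ₊₁ ^ 2`. -/
noncomputable def cubicMinusSquare {n : ℕ} (C : MvPolynomial (Fin n) ℤ) :
    MvPolynomial (Fin (n + 1)) ℤ :=
  rename Fin.castSucc C - X (Fin.last n) ^ 2

/-- The additive character `e_k(a) = exp(2πi a / k)`. -/
noncomputable def expMod (k : ℕ) (a : ℤ) : ℂ :=
  Complex.exp (2 * Real.pi * Complex.I * (a : ℂ) / (k : ℂ))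

/-- The exponential sum `Q(m, k) = ∑*_{h (k)} ∑_{l (k)} e_k(h f(l) + m.l)` with
`f = C - xₙ₊₁ ^ 2`; here `h` runs over the residues modulo `k` coprime to `k`, and `l` over
`(ℤ/kℤ)ⁿ⁺¹`, represented by vectors with entries in `{0, …, k - 1}`. -/
noncomputable def expSumQ {n : ℕ} (C : MvPolynomial (Fin n) ℤ) (m : Fin (n + 1) → ℤ) (k : ℕ) : ℂ :=
  ∑ h ∈ (Finset.range k).filter (fun h => Nat.Coprime h k), ∑ l : Fin (n + 1) → Fin k,
    expMod k ((h : ℤ) * eval (fun i => ((l i : ℕ) : ℤ)) (cubicMinusSquare C)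
      + ∑ i, m i * ((l i : ℕ) : ℤ))

/-- The vector `(m̂, 0)`. -/
def appendZero {n : ℕ} (m : Fin n → ℤ) : Fin (n + 1) → ℤ :=
  Fin.snoc m 0

/-- A natural number is cube-full if it is positive and each of its prime factors divides it at
least three times. -/
def CubeFull (q : ℕ) : Prop :=
  0 < q ∧ ∀ p : ℕ, p.Prime → p ∣ q → p ^ 3 ∣ q

/-- The product of `p ^ 3` over all primes `p` that divide `q` exactly three times. -/
def exactCubePart (q : ℕ) : ℕ :=
  ∏ p ∈ q.primeFactors.filter (fun p => q.factorization p = 3), p ^ 3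

/-- The integer vectors all of whose coordinates are at most `y` in absolute value. -/
noncomputable def intBox (n : ℕ) (y : ℝ) : Finset (Fin n → ℤ) :=
  Fintype.piFinset (fun _ => Finset.Icc (-⌊y⌋) ⌊y⌋)

theorem mem_intBox {n : ℕ} {y : ℝ} {m : Fin n → ℤ} :
    m ∈ intBox n y ↔ ∀ i, |(m i : ℝ)| ≤ y := by
  simp only [intBox, Fintype.mem_piFinset, Finset.mem_Icc, abs_le]
  refine forall_congr' fun i => and_congr ?_ Int.le_floor
  rw [neg_le, Int.le_floor, Int.cast_neg, neg_le]

/-! Write k = k₃l₄ = M²R with R squarefree. Cube-fullness forces R ∣ M, hence k ∣ M³, and Q((m,0),k)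
becomes accessible to stationary phase as a sum over the n + 2 variables (h, l)
(`norm_sum_le_stationary`). Only residue classes modulo M on which the gradient of h f(l) + m·l
vanishes contribute, each at most M^(n+2) times the square root of R^(n+2) times the size of the
Hessian kernel modulo R. At a critical point, 2l_{n+1} = 0, so 2C(u) = 0 for the first n coordinates
u of l, and m ≡ -h∇C(u) modulo M.

Summing over m, each critical point (h, l) pins m to one residue class modulo M. The integral points
of a set of codimension e in such a class number O((1 + y/M)^(n-e)), by elementary counting of zeros
in boxes. There remains the weighted count W of zeros u of F = 2C modulo M, with weight the square
root of the Hessian kernel modulo R (`hessWeightedCount`); the goal is W ≪ M^(n-1+ε) R^(1/2).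

By the Chinese remainder theorem this is local. For a good prime p, Cauchy–Schwarz reduces the count
modulo p to bounding pairs (u, d) with H(u)d = 0. Putting d = u - z and using Euler's identity H(u)u
= 2∇F(u) turns this into 2∇F(u) = H(u)z, a quadratic system with linear right-hand side, which has
O(1) solutions for each z because ∇F has no nontrivial zero modulo p (`sum_hessKer_le`). Hensel
lifting handles primitive zeros modulo p^j; homogeneity makes the imprimitive ones rare enough to
take the trivial weight. Finitely many bad primes cost a constant.

Altogether the sum is ≪ k^ε M^(2n+2) R^(n/2+2) (1 + (y/M)^(n-e)), and comparing M and R with k₃, l₄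
and k gives the two terms, with e = 1 and e = 2. -/

/-! ### Zeros of one or two polynomials in boxes -/

section ZeroCounting
open Finset
open scoped Classical

variable {K : Type*} [Field K]

/-- The induction step for counting in boxes, by fibring over the last n coordinates: `p₁` marks the
fibres controlled by a degree d, `p₂` the exceptional ones that may be full. -/
theorem card_filter_piFinset_succ_le {α : Type*} {n : ℕ} (A : Fin (n + 1) → Finset α)
    (cond : (Fin (n + 1) → α) → Prop) (p₁ p₂ : (Fin n → α) → Prop) (d T : ℕ)
    (h : ∀ x : Fin n → α, #{y ∈ A 0 | cond (Fin.cons y x)} ≤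
      (if p₁ x then d else 0) + (if p₂ x then T else 0)) :
    #{x ∈ Fintype.piFinset A | cond x} ≤
      #{x ∈ Fintype.piFinset (fun i => A (Fin.succ i)) | p₁ x} * d +
      #{x ∈ Fintype.piFinset (fun i => A (Fin.succ i)) | p₂ x} * T := by
  have hmaps : ∀ x ∈ (Fintype.piFinset A).filter cond,
      Fin.tail x ∈ Fintype.piFinset (fun i => A (Fin.succ i)) := by
    intro x hx
    simp only [mem_filter, Fintype.mem_piFinset] at hx ⊢
    exact fun i => hx.1 i.succ
  rw [card_eq_sum_card_fiberwise hmaps]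
  have : ∀ x' ∈ Fintype.piFinset (fun i => A (Fin.succ i)),
      #{x ∈ (Fintype.piFinset A).filter cond | Fin.tail x = x'} ≤
        (if p₁ x' then d else 0) + (if p₂ x' then T else 0) := by
    intro x' _
    refine le_trans ?_ (h x')
    refine card_le_card_of_injOn (fun x => x 0) ?_ ?_
    · intro x hx
      simp only [coe_filter, mem_filter, Fintype.mem_piFinset, Set.mem_ofPred_eq] at hx ⊢
      obtain ⟨⟨h1, h2⟩, h3⟩ := hx
      refine ⟨h1 0, ?_⟩
      rw [← h3, Fin.cons_self_tail]
      exact h2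
    · intro x hx z hz hxz
      simp only [coe_filter, mem_filter, Fintype.mem_piFinset, Set.mem_ofPred_eq] at hx hz
      rw [← Fin.cons_self_tail x, ← Fin.cons_self_tail z, hx.2, hz.2]
      exact congrArg (fun y => (Fin.cons y x' : Fin (n + 1) → α)) hxz
  refine (sum_le_sum this).trans ?_
  rw [sum_add_distrib, sum_ite, sum_ite]
  simp

theorem card_filter_eval_eq_zero_le (A : Finset K) {g : Polynomial K} (hg : g ≠ 0) {d : ℕ}
    (hd : g.natDegree ≤ d) : #{y ∈ A | g.eval y = 0} ≤ d := by
  refine le_trans ?_ ((Polynomial.card_roots' g).trans hd)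
  refine le_trans (card_le_card ?_) (Multiset.toFinset_card_le g.roots)
  intro y hy
  simp only [mem_filter] at hy
  simpa [hg] using hy.2

/-- A nonzero polynomial has at most `c T ^ (n - 1)` zeros in a box with sides of size at most
`T`. -/
theorem exists_card_zeros_le : ∀ (n : ℕ) (P : MvPolynomial (Fin n) K), P ≠ 0 →
    ∃ c : ℕ, ∀ (T : ℕ) (A : Fin n → Finset K), (∀ i, #(A i) ≤ T) →
      #{x ∈ Fintype.piFinset A | eval x P = 0} * T ≤ c * T ^ n := by
  intro n
  induction n with
  | zero =>
    intro P hP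
    refine ⟨0, fun T A _ => ?_⟩
    have : ∀ x : Fin 0 → K, eval x P ≠ 0 := by
      intro x hx
      rw [MvPolynomial.eq_C_of_isEmpty P, eval_C] at hx
      apply hP
      rw [MvPolynomial.eq_C_of_isEmpty P, hx, C_0]
    simp [this]
  | succ n ih =>
    intro P hP
    set q := finSuccEquiv K n P with hq
    have hq0 : q ≠ 0 := by simpa [hq] using hP
    obtain ⟨c, hc⟩ := ih q.leadingCoeff (by simpa using hq0)
    refine ⟨c + q.natDegree, fun T A hA => ?_⟩
    -- View P as a polynomial in the first variable. A fibre has at most deg P points unless the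
    -- leading coefficient vanishes, which by induction is rare. Multiplying by T instead of writing
    -- T ^ (n - 1) keeps the induction free of truncated subtraction.
    have key := card_filter_piFinset_succ_le A (fun x => eval x P = 0) (fun _ => True)
      (fun x => eval x q.leadingCoeff = 0) q.natDegree T (by
        intro x
        by_cases hx : eval x q.leadingCoeff = 0
        · simp only [hx, if_true]
          exact (card_filter_le _ _).trans ((hA 0).trans (Nat.le_add_left _ _))
        · simp only [hx, if_true, if_false, add_zero]
          simp_rw [eval_eq_eval_mv_eval']
          refine card_filter_eval_eq_zero_le (A 0) ?_ Polynomial.natDegree_map_le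
          intro h0
          apply hx
          have := congrArg (fun g => Polynomial.coeff g q.natDegree) h0
          rwa [Polynomial.coeff_map, Polynomial.coeff_zero] at this)
    have h1 := hc T (fun i => A i.succ) (fun i => hA _)
    rw [filter_true] at key
    have h2 : #(Fintype.piFinset (fun i => A (Fin.succ i))) ≤ T ^ n := by
      rw [Fintype.card_piFinset]
      calc _ ≤ ∏ i : Fin n, T := prod_le_prod' fun i _ => hA _
        _ = _ := by simp
    calc _ ≤ _ := Nat.mul_le_mul_right T key
      _ = #(Fintype.piFinset (fun i => A (Fin.succ i))) * (q.natDegree * T) +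
          (#{x ∈ Fintype.piFinset (fun i => A (Fin.succ i)) | eval x q.leadingCoeff = 0} * T)
            * T := by ring
      _ ≤ T ^ n * (q.natDegree * T) + (c * T ^ n) * T := by gcongr
      _ = _ := by ring

/-- Split the zeros of a among its irreducible factors π; for each π some b in S is not divisible by
π, and the codimension two bound applies to the pair. It is meant for the coefficients S of a
primitive polynomial and a its leading coefficient. -/
theorem exists_card_commonZeros_le_of_factors {n : ℕ}
    (hn : ∀ P Q : MvPolynomial (Fin n) K, Irreducible P → ¬ P ∣ Q →
      ∃ c : ℕ, ∀ (T : ℕ) (A : Fin n → Finset K), (∀ i, #(A i) ≤ T) →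
        #{x ∈ Fintype.piFinset A | eval x P = 0 ∧ eval x Q = 0} * T ^ 2 ≤ c * T ^ n)
    (S : Set (MvPolynomial (Fin n) K)) (a : MvPolynomial (Fin n) K) (ha : a ≠ 0)
    (hS : ∀ π, Irreducible π → π ∣ a → ∃ b ∈ S, ¬ π ∣ b) :
    ∃ c : ℕ, ∀ (T : ℕ) (A : Fin n → Finset K), (∀ i, #(A i) ≤ T) →
        #{x ∈ Fintype.piFinset A | eval x a = 0 ∧ ∀ b ∈ S, eval x b = 0} * T ^ 2 ≤ c * T ^ n := by
  induction a using WfDvdMonoid.induction_on_irreducible with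
  | zero => exact absurd rfl ha
  | unit u hu =>
    refine ⟨0, fun T A _ => ?_⟩
    have : ∀ x : Fin n → K, eval x u ≠ 0 := fun x => (hu.map (eval x)).ne_zero
    simp [this]
  | mul a π ha0 hπ ih =>
    obtain ⟨c₁, hc₁⟩ := ih ha0 fun π' h1 h2 => hS π' h1 (h2.mul_left π)
    obtain ⟨b, hbS, hb⟩ := hS π hπ (dvd_mul_right _ _)
    obtain ⟨c₂, hc₂⟩ := hn π b hπ hb
    refine ⟨c₂ + c₁, fun T A hA => ?_⟩
    have hsub : (Fintype.piFinset A).filter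
        (fun x => eval x (π * a) = 0 ∧ ∀ b ∈ S, eval x b = 0) ⊆
        (Fintype.piFinset A).filter (fun x => eval x π = 0 ∧ eval x b = 0) ∪
        (Fintype.piFinset A).filter (fun x => eval x a = 0 ∧ ∀ b ∈ S, eval x b = 0) := by
      intro x hx
      simp only [mem_filter, mem_union, map_mul, mul_eq_zero] at hx ⊢
      obtain ⟨h1, h2 | h2, h3⟩ := hx
      · exact Or.inl ⟨h1, h2, h3 b hbS⟩
      · exact Or.inr ⟨h1, h2, h3⟩
    calc _ ≤ _ := Nat.mul_le_mul_right _ ((card_le_card hsub).trans (card_union_le _ _))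
      _ ≤ c₂ * T ^ n + c₁ * T ^ n := by
        rw [add_mul]
        exact add_le_add (hc₂ T A hA) (hc₁ T A hA)
      _ = _ := by ring

/-- By Gauss's lemma P stays irreducible, hence coprime to Q, over the fraction field; clearing
denominators in a Bézout relation gives r, which plays the part of a resultant. -/
theorem exists_bezout_of_irreducible_of_not_dvd {R : Type*} [CommRing R] [IsDomain R]
    [NormalizedGCDMonoid R] {P Q : Polynomial R} (hP : Irreducible P)
    (hdeg : P.natDegree ≠ 0) (hPQ : ¬ P ∣ Q) :
    ∃ r : R, r ≠ 0 ∧ ∃ a b : Polynomial R, a * P + b * Q = Polynomial.C r := by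
  have hprim : P.IsPrimitive := hP.isPrimitive hdeg
  have hirr := (hprim.irreducible_iff_irreducible_map_fraction_map (K := FractionRing R)).1 hP
  have hdvd : ¬ P.map (algebraMap R (FractionRing R)) ∣ Q.map (algebraMap R (FractionRing R)) := by
    intro h
    exact hPQ (hprim.dvd_of_fraction_map_dvd_fraction_map h)
  obtain ⟨u, v, huv⟩ := (hirr.coprime_iff_not_dvd).2 hdvd
  obtain ⟨b₁, hm₁, hb₁⟩ := IsLocalization.integerNormalization_spec (nonZeroDivisors R) u
  obtain ⟨b₂, hm₂, hb₂⟩ := IsLocalization.integerNormalization_spec (nonZeroDivisors R) v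
  refine ⟨b₁ * b₂, mul_ne_zero (nonZeroDivisors.ne_zero hm₁) (nonZeroDivisors.ne_zero hm₂),
    Polynomial.C b₂ * IsLocalization.integerNormalization (nonZeroDivisors R) u,
    Polynomial.C b₁ * IsLocalization.integerNormalization (nonZeroDivisors R) v, ?_⟩
  apply Polynomial.map_injective _ (IsFractionRing.injective R (FractionRing R))
  simp only [Polynomial.map_add, Polynomial.map_mul, hb₁, hb₂, Polynomial.map_C, map_mul,
    Algebra.smul_def, Polynomial.algebraMap_apply]
  linear_combination Polynomial.C (algebraMap R (FractionRing R) b₁) *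
    Polynomial.C (algebraMap R (FractionRing R) b₂) * huv

/-- If `P` is irreducible and does not divide `Q`, then `P` and `Q` have at most `c T ^ (n - 2)`
common zeros in a box with sides of size at most `T`. -/
theorem exists_card_commonZeros_le : ∀ (n : ℕ) (P Q : MvPolynomial (Fin n) K), Irreducible P →
    ¬ P ∣ Q → ∃ c : ℕ, ∀ (T : ℕ) (A : Fin n → Finset K), (∀ i, #(A i) ≤ T) →
      #{x ∈ Fintype.piFinset A | eval x P = 0 ∧ eval x Q = 0} * T ^ 2 ≤ c * T ^ n := by
  intro n
  induction n with
  | zero =>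
    intro P Q hP _
    exfalso
    rw [MvPolynomial.eq_C_of_isEmpty P] at hP
    have h0 : coeff 0 P ≠ 0 := fun h => hP.ne_zero (by rw [h, C_0])
    exact hP.not_isUnit ((isUnit_iff_ne_zero.2 h0).map C)
  | succ n ih =>
    intro P Q hP hPQ
    let _ : NormalizedGCDMonoid (MvPolynomial (Fin n) K) :=
      letI := UniqueFactorizationMonoid.strongNormalizationMonoid (α := MvPolynomial (Fin n) K)
      UniqueFactorizationMonoid.toNormalizedGCDMonoid _
    set p := finSuccEquiv K n P with hp
    set q := finSuccEquiv K n Q with hq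
    have hpirr : Irreducible p := (MulEquiv.irreducible_iff (finSuccEquiv K n)).2 hP
    have hpq : ¬ p ∣ q := fun h => hPQ ((map_dvd_iff (finSuccEquiv K n)).1 h)
    -- If P does not involve the first variable, P = a, some coefficient of Q is not divisible by a.
    -- Over zeros of a where it is nonzero, Q has boundedly many zeros; its common zeros with a are
    -- handled by induction.
    by_cases hdeg : p.natDegree = 0
    · obtain ⟨a, ha⟩ : ∃ a, p = Polynomial.C a := ⟨_, Polynomial.eq_C_of_natDegree_eq_zero hdeg⟩
      have hair : Irreducible a := by
        have := hpirr.prime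
        rw [ha, Polynomial.prime_C_iff] at this
        exact this.irreducible
      obtain ⟨i, hi⟩ : ∃ i, ¬ a ∣ q.coeff i := by
        by_contra! h
        exact hpq (ha ▸ (Polynomial.C_dvd_iff_dvd_coeff a q).2 h)
      obtain ⟨c₁, hc₁⟩ := exists_card_zeros_le n a hair.ne_zero
      obtain ⟨c₂, hc₂⟩ := ih a (q.coeff i) hair hi
      refine ⟨c₁ * q.natDegree + c₂, fun T A hA => ?_⟩
      have key := card_filter_piFinset_succ_le A (fun x => eval x P = 0 ∧ eval x Q = 0)
        (fun x => eval x a = 0) (fun x => eval x a = 0 ∧ eval x (q.coeff i) = 0) q.natDegree T (by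
          intro x
          simp_rw [eval_eq_eval_mv_eval', ← hp, ← hq, ha, Polynomial.map_C, Polynomial.eval_C]
          by_cases hx : eval x a = 0
          · by_cases hx' : eval x (q.coeff i) = 0
            · simp only [hx, hx', if_true, and_self]
              exact (card_filter_le _ _).trans ((hA 0).trans (Nat.le_add_left _ _))
            · simp only [hx, hx', true_and, if_true, if_false, add_zero]
              refine card_filter_eval_eq_zero_le (A 0) ?_ Polynomial.natDegree_map_le
              intro h0
              apply hx'
              have := congrArg (fun g => Polynomial.coeff g i) h0
              simpa [Polynomial.coeff_map] using this
          · simp [hx])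
      have h1 := hc₁ T (fun i => A i.succ) (fun i => hA _)
      have h2 := hc₂ T (fun i => A i.succ) (fun i => hA _)
      have bound := calc _ ≤ _ := Nat.mul_le_mul_right (T ^ 2) key
        _ = (#{x ∈ Fintype.piFinset (fun i => A (Fin.succ i)) | eval x a = 0} * T) *
              (q.natDegree * T) +
            (#{x ∈ Fintype.piFinset (fun i => A (Fin.succ i)) |
              eval x a = 0 ∧ eval x (q.coeff i) = 0} * T ^ 2) * T := by ring_nf
        _ ≤ (c₁ * T ^ n) * (q.natDegree * T) + (c₂ * T ^ n) * T := by gcongr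
        _ = (c₁ * q.natDegree + c₂) * T ^ (n + 1) := by ring
      convert bound
    -- Otherwise common zeros lie over zeros of r, with at most deg p points in a fibre, unless all
    -- coefficients of p vanish there. Since p is primitive the latter locus has codimension two.
    · obtain ⟨r, hr0, u, v, huv⟩ := exists_bezout_of_irreducible_of_not_dvd hpirr hdeg hpq
      obtain ⟨c₁, hc₁⟩ := exists_card_zeros_le n r hr0
      obtain ⟨c₂, hc₂⟩ := exists_card_commonZeros_le_of_factors ih (Set.range p.coeff)
        p.leadingCoeff (by simpa using hpirr.ne_zero) (by
          intro π hπ _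
          by_contra! h
          have := (Polynomial.C_dvd_iff_dvd_coeff π p).2 fun i => h _ ⟨i, rfl⟩
          exact hπ.not_isUnit ((hpirr.isPrimitive hdeg) π this))
      refine ⟨c₁ * p.natDegree + c₂, fun T A hA => ?_⟩
      have key := card_filter_piFinset_succ_le A (fun x => eval x P = 0 ∧ eval x Q = 0)
        (fun x => eval x r = 0)
        (fun x => eval x p.leadingCoeff = 0 ∧ ∀ b ∈ Set.range p.coeff, eval x b = 0)
        p.natDegree T (by
          intro x
          simp_rw [eval_eq_eval_mv_eval', ← hp, ← hq]
          by_cases hx' : ∀ b ∈ Set.range p.coeff, eval x b = 0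
          · have hx : eval x p.leadingCoeff = 0 := hx' _ ⟨_, rfl⟩
            rw [if_pos (c := _ ∧ _) ⟨hx, hx'⟩]
            exact (card_filter_le _ _).trans ((hA 0).trans (Nat.le_add_left _ _))
          · rw [if_neg (c := _ ∧ _) fun h => hx' h.2, add_zero]
            split_ifs with hx
            · refine le_trans (card_le_card (t := {y ∈ A 0 |
                Polynomial.eval y (Polynomial.map (eval x) p) = 0}) ?_)
                (card_filter_eval_eq_zero_le (A 0) ?_ Polynomial.natDegree_map_le)
              · intro y hy
                simp only [mem_filter] at hy ⊢
                exact ⟨hy.1, hy.2.1⟩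
              · intro h0
                apply hx'
                rintro _ ⟨i, rfl⟩
                have := congrArg (fun g => Polynomial.coeff g i) h0
                simpa [Polynomial.coeff_map] using this
            · rw [Nat.le_zero, card_eq_zero, filter_eq_empty_iff]
              rintro y _ ⟨h1, h2⟩
              apply hx
              have := congrArg (fun g => Polynomial.eval y (Polynomial.map (eval x) g)) huv
              simpa [h1, h2] using this.symm)
      have h1 := hc₁ T (fun i => A i.succ) (fun i => hA _)
      have h2 := hc₂ T (fun i => A i.succ) (fun i => hA _)
      have bound := calc _ ≤ _ := Nat.mul_le_mul_right (T ^ 2) key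
        _ = (#{x ∈ Fintype.piFinset (fun i => A (Fin.succ i)) | eval x r = 0} * T) *
              (p.natDegree * T) +
            (#{x ∈ Fintype.piFinset (fun i => A (Fin.succ i)) |
              eval x p.leadingCoeff = 0 ∧ ∀ b ∈ Set.range p.coeff, eval x b = 0} * T ^ 2) * T := by
            ring_nf
        _ ≤ (c₁ * T ^ n) * (p.natDegree * T) + (c₂ * T ^ n) * T := by gcongr
        _ = (c₁ * p.natDegree + c₂) * T ^ (n + 1) := by ring
      convert bound

end ZeroCounting

/-! ### Taylor expansion over commutative rings -/

section Taylor

variable {ι S : Type*} [CommRing S]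

theorem aeval_pderiv_X [DecidableEq ι] (x : ι → S) (i k : ι) :
    aeval x (pderiv i (X k : MvPolynomial ι ℤ)) = if i = k then 1 else 0 := by
  rw [pderiv_X, Pi.single_apply]
  split_ifs with h1 h2 h2
  · simp
  · exact absurd h1.symm h2
  · exact absurd h2.symm h1
  · simp

theorem pderiv_pderiv_X (i j k : ι) : pderiv i (pderiv j (X k : MvPolynomial ι ℤ)) = 0 := by
  classical
  rw [pderiv_X, Pi.single_apply]
  split_ifs <;> simp

theorem aeval_add_mul [Fintype ι] (φ : MvPolynomial ι ℤ) (x y : ι → S) (N : S) :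
    ∃ r, aeval (fun i => x i + N * y i) φ =
      aeval x φ + N * ∑ i, y i * aeval x (pderiv i φ) + N ^ 2 * r := by
  classical
  induction φ using MvPolynomial.induction_on with
  | C a => exact ⟨0, by simp⟩
  | add p q hp hq =>
    obtain ⟨r, hr⟩ := hp
    obtain ⟨s, hs⟩ := hq
    refine ⟨r + s, ?_⟩
    simp only [map_add, mul_add, Finset.sum_add_distrib, hr, hs]
    ring
  | mul_X p k hp =>
    obtain ⟨r, hr⟩ := hp
    have hsum : ∑ i, y i * aeval x (pderiv i (p * X k)) =
        x k * ∑ i, y i * aeval x (pderiv i p) + y k * aeval x p := by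
      simp only [pderiv_mul, map_add, map_mul, aeval_pderiv_X, aeval_X, mul_add,
        Finset.sum_add_distrib, mul_ite, mul_one, mul_zero, Finset.sum_ite_eq', Finset.mem_univ,
        if_true, Finset.mul_sum]
      congr 1
      exact Finset.sum_congr rfl fun i _ => by ring
    refine ⟨x k * r + y k * (∑ i, y i * aeval x (pderiv i p)) + N * y k * r, ?_⟩
    rw [hsum, map_mul, map_mul, hr, aeval_X, aeval_X]
    ring

theorem aeval_add_mul_sub [Fintype ι] (φ : MvPolynomial ι ℤ) (x y : ι → S) (N : S) :
    ∃ r, aeval (fun i => x i + N * y i) φ = aeval x φ + N * r := by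
  obtain ⟨r, hr⟩ := aeval_add_mul φ x y N
  exact ⟨∑ i, y i * aeval x (pderiv i φ) + N * r, by rw [hr]; ring⟩

/-- In a mixed second difference the terms in v alone and in d alone cancel, so the Hessian appears
as a bilinear form without the factor 1/2. This is what makes the argument valid at the prime 2. -/
theorem aeval_mixed_difference [Fintype ι] (φ : MvPolynomial ι ℤ) (x v d : ι → S) (N : S) :
    ∃ r, aeval (fun i => x i + N * (v i + d i)) φ - aeval (fun i => x i + N * v i) φ =
      aeval (fun i => x i + N * d i) φ - aeval x φ +
      N ^ 2 * ∑ i, v i * ∑ j, aeval x (pderiv i (pderiv j φ)) * d j + N ^ 3 * r := by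
  classical
  induction φ using MvPolynomial.induction_on with
  | C a => exact ⟨0, by simp⟩
  | add p q hp hq =>
    obtain ⟨r, hr⟩ := hp
    obtain ⟨s, hs⟩ := hq
    refine ⟨r + s, ?_⟩
    simp only [map_add, mul_add, add_mul, Finset.sum_add_distrib]
    simp only [mul_add] at hr hs
    linear_combination hr + hs
  | mul_X p k hp =>
    obtain ⟨r, hr⟩ := hp
    have hsum : ∑ i, v i * ∑ j, aeval x (pderiv i (pderiv j (p * X k))) * d j =
        x k * ∑ i, v i * ∑ j, aeval x (pderiv i (pderiv j p)) * d j +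
        d k * (∑ i, v i * aeval x (pderiv i p)) + v k * ∑ j, d j * aeval x (pderiv j p) := by
      simp only [pderiv_mul, map_add, map_mul, aeval_pderiv_X, aeval_X, mul_add, add_mul,
        Finset.sum_add_distrib, mul_ite, mul_one, mul_zero, ite_mul, zero_mul,
        Finset.sum_ite_eq', Finset.mem_univ, pderiv_pderiv_X,
        if_true, Finset.mul_sum, add_zero]
      have h3 : ∀ i, (∑ j, v i * ((if i = k then aeval x (pderiv j p) else 0) * d j)) =
          if i = k then ∑ j, v i * (aeval x (pderiv j p) * d j) else 0 := by
        intro i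
        split_ifs <;> simp
      simp only [ite_mul, zero_mul, mul_ite, mul_zero] at h3
      simp only [h3, Finset.sum_ite_eq', Finset.mem_univ, if_true]
      rw [add_right_comm]
      refine congrArg₂ _ (congrArg₂ _ ?_ ?_) ?_
      · exact Finset.sum_congr rfl fun i _ => Finset.sum_congr rfl fun j _ => by ring
      · exact Finset.sum_congr rfl fun i _ => by ring
      · exact Finset.sum_congr rfl fun i _ => by ring
    obtain ⟨s, hs⟩ := aeval_add_mul p x v N
    obtain ⟨t, ht⟩ := aeval_add_mul p x d N
    obtain ⟨w, hw⟩ := aeval_add_mul p x (fun i => v i + d i) N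
    refine ⟨x k * r + v k * (w - s) + d k * (w - t), ?_⟩
    rw [hsum]
    simp only [map_mul, aeval_X]
    simp only [add_mul, Finset.sum_add_distrib] at hw
    set a₁ := aeval (fun i => x i + N * (v i + d i)) p
    set a₂ := aeval (fun i => x i + N * v i) p
    set a₃ := aeval (fun i => x i + N * d i) p
    linear_combination x k * hr + N * v k * hw + N * d k * hw - N * v k * hs - N * d k * ht
end Taylor

/-! ### Exponential sums over one residue class: vanishing and Weyl differencing -/

section StationaryPhase
open Finset
open scoped Classical

/-- All fibres of a surjective homomorphism have the same size; cross-multiplied to avoid division.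
-/
theorem card_mul_sum_comp_surjective {G H : Type*} [AddCommGroup G] [AddCommGroup H] [Fintype G]
    [Fintype H] (f : G →+ H) (hf : Function.Surjective f) {R : Type*} [CommSemiring R]
    (F : H → R) : (Fintype.card H : R) * ∑ g, F (f g) = Fintype.card G * ∑ h, F h := by
  have hfib : ∀ h, #{g | f g = h} = #{g | f g = 0} := fun h =>
    AddMonoidHom.card_fiber_eq_of_mem_range f (hf h) (hf 0)
  have hcard : Fintype.card G = Fintype.card H * #{g | f g = 0} := by
    rw [← Finset.card_univ, card_eq_sum_card_fiberwise (f := f) (t := univ) (by simp)]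
    simp [hfib]
  have hsum : ∑ g, F (f g) = #{g | f g = 0} * ∑ h, F h := by
    rw [← Finset.sum_fiberwise univ f, mul_sum]
    refine sum_congr rfl fun h _ => ?_
    rw [sum_congr rfl (g := fun _ => F h) (by simp +contextual)]
    simp [hfib]
  rw [hsum, hcard]
  push_cast
  ring

theorem card_filter_comp_surjective {G H : Type*} [AddCommGroup G] [AddCommGroup H] [Fintype G]
    [Fintype H] (f : G →+ H) (hf : Function.Surjective f) (p : H → Prop) [DecidablePred p] :
    Fintype.card H * #{g | p (f g)} = Fintype.card G * #{h | p h} := by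
  have := card_mul_sum_comp_surjective f hf (fun h => if p h then 1 else 0 : H → ℕ)
  simpa using this

/-- Reduction modulo `b` of a vector modulo `a`, for `b ∣ a`. -/
noncomputable def reduceVec {ι : Type*} {a b : ℕ} (h : b ∣ a) : (ι → ZMod a) →+ (ι → ZMod b) :=
  (ZMod.castHom h (ZMod b)).toAddMonoidHom.compLeft ι

@[simp] theorem reduceVec_apply {ι : Type*} {a b : ℕ} (h : b ∣ a) (v : ι → ZMod a) (i : ι) :
    reduceVec h v i = ZMod.castHom h (ZMod b) (v i) := rfl

theorem reduceVec_surjective {ι : Type*} {a b : ℕ} (h : b ∣ a) :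
    Function.Surjective (reduceVec (ι := ι) h) := by
  intro w
  choose v hv using fun i => ZMod.castHom_surjective h (w i)
  exact ⟨v, funext hv⟩

theorem aeval_reduceVec {ι : Type*} {a b : ℕ} (h : b ∣ a) (v : ι → ZMod a)
    (φ : MvPolynomial ι ℤ) : aeval (reduceVec h v) φ = ZMod.castHom h (ZMod b) (aeval v φ) := by
  have := MvPolynomial.map_aeval (R := ℤ) v (ZMod.castHom h (ZMod b)) φ
  rw [this, aeval_def, coe_eval₂Hom]
  congr 1
  exact RingHom.ext_int _ _

theorem natCast_mul_eq_zero_iff_castHom {a b c : ℕ} [NeZero b] (h : b * c = a) (hca : c ∣ a)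
    (z : ZMod a) : (b : ZMod a) * z = 0 ↔ ZMod.castHom hca (ZMod c) z = 0 := by
  obtain ⟨m, rfl⟩ := ZMod.intCast_surjective z
  rw [map_intCast, ZMod.intCast_zmod_eq_zero_iff_dvd, ← Int.cast_natCast, ← Int.cast_mul,
    ZMod.intCast_zmod_eq_zero_iff_dvd, ← h]
  push_cast
  exact mul_dvd_mul_iff_left (by exact_mod_cast NeZero.ne b)

theorem addChar_sum {ι A R : Type*} [AddCommMonoid A] [CommMonoid R] (ψ : AddChar A R)
    (s : Finset ι) (f : ι → A) : ψ (∑ i ∈ s, f i) = ∏ i ∈ s, ψ (f i) := by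
  induction s using Finset.induction_on with
  | empty => simp
  | insert a s ha ih => rw [sum_insert ha, prod_insert ha, AddChar.map_add_eq_mul, ih]

theorem sum_stdAddChar_linear {ι : Type*} [Fintype ι] [DecidableEq ι] {k : ℕ} [NeZero k] (c : ι → ZMod k) :
    ∑ v : ι → ZMod k, ZMod.stdAddChar (∑ i, v i * c i) =
      if c = 0 then ((k ^ Fintype.card ι : ℕ) : ℂ) else 0 := by
  have h1 : ∀ v : ι → ZMod k, ZMod.stdAddChar (∑ i, v i * c i) =
      ∏ i, ZMod.stdAddChar (v i * c i) := fun v => addChar_sum _ _ _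
  simp_rw [h1]
  rw [← Fintype.piFinset_univ, Finset.sum_prod_piFinset univ
    (fun i (y : ZMod k) => ZMod.stdAddChar (y * c i))]
  simp_rw [AddChar.sum_mulShift _ (ZMod.isPrimitive_stdAddChar k)]
  split_ifs with hc
  · subst hc
    simp [ZMod.card]
  · obtain ⟨i, hi⟩ := Function.ne_iff.1 hc
    exact prod_eq_zero (mem_univ i) (by rw [if_neg (by simpa using hi)]; simp)

theorem norm_stdAddChar {k : ℕ} [NeZero k] (a : ZMod k) : ‖(ZMod.stdAddChar a : ℂ)‖ = 1 := by
  rw [ZMod.stdAddChar_apply]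
  exact Circle.norm_coe _

theorem conj_stdAddChar {k : ℕ} [NeZero k] (a : ZMod k) :
    (starRingEnd ℂ) (ZMod.stdAddChar a) = ZMod.stdAddChar (-a) := by
  rw [ZMod.stdAddChar_apply, ZMod.stdAddChar_apply, AddChar.map_neg_eq_inv, Circle.coe_inv_eq_conj]

variable {ι : Type*} [Fintype ι] [DecidableEq ι]

/-- The Hessian of `φ` at `a`, applied to `d`. -/
noncomputable def hessMul {S : Type*} [CommRing S] (φ : MvPolynomial ι ℤ) (a d : ι → S) (i : ι) : S :=
  ∑ j, aeval a (pderiv i (pderiv j φ)) * d j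

omit [DecidableEq ι] in
theorem hessMul_reduceVec {a b : ℕ} (h : b ∣ a) (φ : MvPolynomial ι ℤ) (x d : ι → ZMod a) (i : ι) :
    hessMul φ (reduceVec h x) (reduceVec h d) i = ZMod.castHom h (ZMod b) (hessMul φ x d i) := by
  simp only [hessMul, map_sum, map_mul, aeval_reduceVec, reduceVec_apply]

/-- The number of vectors modulo `R` that are annihilated by the Hessian of `φ` at `a`. -/
noncomputable def hessKer (φ : MvPolynomial ι ℤ) {R : ℕ} [NeZero R] (a : ι → ZMod R) : ℕ :=
  #{d : ι → ZMod R | ∀ i, hessMul φ a d i = 0}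

/-- Shifting v by R times the i-th unit vector adds the constant M R ∂ᵢφ(x) to the phase, everything
of higher order being divisible by M · MR = k. So the sum equals itself times a nontrivial root of
unity. -/
theorem shifted_sum_eq_zero {k M R : ℕ} [NeZero k] (hk : k = M * (M * R)) (φ : MvPolynomial ι ℤ)
    (x : ι → ZMod k) {i : ι} (hi : ((M * R : ℕ) : ZMod k) * aeval x (pderiv i φ) ≠ 0) :
    ∑ v : ι → ZMod k, ZMod.stdAddChar (aeval (fun i => x i + (M : ZMod k) * v i) φ) = 0 := by
  have hk0 : (M : ZMod k) * (M * R) = 0 := by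
    rw [← Nat.cast_mul, ← Nat.cast_mul, ← hk, ZMod.natCast_self]
  set T := ∑ v : ι → ZMod k, ZMod.stdAddChar (aeval (fun i => x i + (M : ZMod k) * v i) φ) with hT
  set g := ((M * R : ℕ) : ZMod k) * aeval x (pderiv i φ) with hg
  have hstep : ∀ v : ι → ZMod k,
      aeval (fun j => x j + (M : ZMod k) * (v j + (R : ZMod k) * (Pi.single i 1 : ι → ZMod k) j)) φ =
        aeval (fun j => x j + (M : ZMod k) * v j) φ + g := by
    intro v
    obtain ⟨r, hr⟩ := aeval_add_mul φ (fun j => x j + (M : ZMod k) * v j) (Pi.single i 1)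
      (M * R : ZMod k)
    obtain ⟨s, hs⟩ := aeval_add_mul_sub (pderiv i φ) x v (M : ZMod k)
    have h1 : (fun j => x j + (M : ZMod k) * (v j + (R : ZMod k) * (Pi.single i 1 : ι → ZMod k) j)) =
        fun j => x j + (M : ZMod k) * v j + (M * R : ZMod k) * (Pi.single i 1 : ι → ZMod k) j := by
      funext j; ring
    have h2 : ∑ j, (Pi.single i 1 : ι → ZMod k) j *
        aeval (fun j => x j + (M : ZMod k) * v j) (pderiv j φ) =
        aeval (fun j => x j + (M : ZMod k) * v j) (pderiv i φ) := by
      rw [Finset.sum_eq_single i] <;> simp +contextual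
    rw [h1, hr, h2, hs, hg]
    push_cast
    linear_combination (s + R * r) * hk0
  have hshift : T = T * ZMod.stdAddChar g := by
    conv_lhs => rw [hT, ← Equiv.sum_comp (Equiv.addRight (fun j => (R : ZMod k) * (Pi.single i 1 : ι → ZMod k) j))]
    rw [hT, sum_mul]
    refine sum_congr rfl fun v _ => ?_
    rw [← AddChar.map_add_eq_mul, ← hstep v]
    rfl
  have hg1 : (ZMod.stdAddChar g : ℂ) ≠ 1 := by
    intro h
    apply hi
    apply ZMod.injective_stdAddChar
    rw [h, AddChar.map_zero_eq_one]
  have : T * (ZMod.stdAddChar g - 1) = 0 := by linear_combination -hshift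
  exact (mul_eq_zero.1 this).resolve_right (sub_ne_zero.2 hg1)

/-- Weyl differencing. As R ∣ M, the cube of M vanishes modulo k, so the differenced phase is
exactly linear in v with coefficients M² H(x)d. The complete sum over v detects M² H(x)d = 0 modulo
k, that is, H(x)d = 0 modulo R. -/
theorem norm_shifted_sum_sq_le {k M R : ℕ} [NeZero k] [NeZero R] (hk : k = M ^ 2 * R) (hRM : R ∣ M)
    (hRk : R ∣ k) (φ : MvPolynomial ι ℤ) (x : ι → ZMod k) :
    ‖∑ v : ι → ZMod k, ZMod.stdAddChar (aeval (fun i => x i + (M : ZMod k) * v i) φ)‖ ^ 2 * R ^ Fintype.card ι ≤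
      (k ^ Fintype.card ι : ℝ) ^ 2 * hessKer φ (reduceVec hRk x) := by
  have : NeZero (M ^ 2) := ⟨fun h => NeZero.ne k (by rw [hk, h, zero_mul])⟩
  have hM3 : (M : ZMod k) ^ 3 = 0 := by
    obtain ⟨m, hm⟩ := hRM
    have hkR : (M : ZMod k) ^ 2 * (R : ZMod k) = 0 := by
      rw [← Nat.cast_pow, ← Nat.cast_mul, ← hk, ZMod.natCast_self]
    have hm' : (M : ZMod k) = R * m := by exact_mod_cast congrArg (Nat.cast : ℕ → ZMod k) hm
    linear_combination (m : ZMod k) * hkR + (M : ZMod k) ^ 2 * hm'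
  set E : (ι → ZMod k) → ZMod k := fun v => aeval (fun i => x i + (M : ZMod k) * v i) φ with hE
  set T := ∑ v, (ZMod.stdAddChar (E v) : ℂ) with hT
  have hdiff : ∀ v d : ι → ZMod k, E (v + d) - E v = (E d - E 0) +
      ∑ i, v i * (((M ^ 2 : ℕ) : ZMod k) * hessMul φ x d i) := by
    intro v d
    obtain ⟨r, hr⟩ := aeval_mixed_difference φ x v d (M : ZMod k)
    have h0 : E 0 = aeval x φ := by simp [hE]
    rw [h0]
    refine hr.trans ?_
    rw [hM3, zero_mul, add_zero, mul_sum]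
    refine congrArg₂ _ rfl (sum_congr rfl fun i _ => ?_)
    rw [hessMul]
    push_cast
    ring
  have hsq : (T * (starRingEnd ℂ) T) = ∑ d, ZMod.stdAddChar (E d - E 0) *
      ∑ v : ι → ZMod k, ZMod.stdAddChar (∑ i, v i * (((M ^ 2 : ℕ) : ZMod k) * hessMul φ x d i)) := by
    simp_rw [mul_sum]
    rw [sum_comm, hT, map_sum, mul_comm, sum_mul]
    refine sum_congr rfl fun v _ => ?_
    rw [mul_sum, ← Equiv.sum_comp (Equiv.addLeft v)]
    refine sum_congr rfl fun d _ => ?_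
    rw [conj_stdAddChar, ← AddChar.map_add_eq_mul, ← AddChar.map_add_eq_mul, ← hdiff]
    congr 1
    simp only [Equiv.coe_addLeft]
    ring
  have hle : ‖T‖ ^ 2 ≤ ∑ d : ι → ZMod k,
      if (fun i => ((M ^ 2 : ℕ) : ZMod k) * hessMul φ x d i) = 0 then (k ^ Fintype.card ι : ℝ) else 0 := by
    have : ‖T‖ ^ 2 = ‖T * (starRingEnd ℂ) T‖ := by
      rw [norm_mul, RCLike.norm_conj, sq]
    rw [this, hsq]
    refine (norm_sum_le _ _).trans (sum_le_sum fun d _ => ?_)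
    rw [norm_mul, norm_stdAddChar, one_mul,
      sum_stdAddChar_linear (fun i => ((M ^ 2 : ℕ) : ZMod k) * hessMul φ x d i)]
    split_ifs <;> simp
  have hcount : R ^ Fintype.card ι *
      #{d : ι → ZMod k | (fun i => ((M ^ 2 : ℕ) : ZMod k) * hessMul φ x d i) = 0} =
      k ^ Fintype.card ι * hessKer φ (reduceVec hRk x) := by
    have := card_filter_comp_surjective (reduceVec (ι := ι) hRk) (reduceVec_surjective hRk)
      (fun d => ∀ i, hessMul φ (reduceVec hRk x) d i = 0)
    simp only [Fintype.card_pi, ZMod.card, prod_const, Finset.card_univ] at this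
    rw [hessKer]
    refine Eq.trans ?_ (this.trans (by congr))
    refine congrArg₂ _ rfl (congrArg card ?_)
    ext d
    simp only [mem_filter, mem_univ, true_and]
    rw [funext_iff]
    refine forall_congr' fun i => ?_
    rw [hessMul_reduceVec, ← natCast_mul_eq_zero_iff_castHom hk.symm hRk]
    rfl
  rw [← sum_filter, sum_const, nsmul_eq_mul] at hle
  have hc : (R ^ Fintype.card ι : ℝ) *
      #{d : ι → ZMod k | (fun i => ((M ^ 2 : ℕ) : ZMod k) * hessMul φ x d i) = 0} =
      k ^ Fintype.card ι * hessKer φ (reduceVec hRk x) := by exact_mod_cast hcount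
  calc _ ≤ _ := mul_le_mul_of_nonneg_right hle (by positivity)
    _ = ((R ^ Fintype.card ι : ℝ) * #{d : ι → ZMod k | (fun i => ((M ^ 2 : ℕ) : ZMod k) * hessMul φ x d i) = 0})
      * k ^ Fintype.card ι := by ring
    _ = _ := by rw [hc]; ring

end StationaryPhase

/-! ### Assembling the stationary phase estimate -/

section StationaryPhaseBound
open Finset
open scoped Classical
variable {ι : Type*}

theorem reduceVec_reduceVec {a b c : ℕ} (h : b ∣ a) (h' : c ∣ b) (v : ι → ZMod a) :
    reduceVec h' (reduceVec h v) = reduceVec (h'.trans h) v := by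
  funext i
  simp only [reduceVec_apply]
  exact DFunLike.congr_fun (ZMod.castHom_comp h' h) (v i)

variable [Fintype ι] [DecidableEq ι]

theorem norm_fiber_sum_le {k M R : ℕ} [NeZero k] [NeZero M] [NeZero R] (hk : k = M ^ 2 * R)
    (hRM : R ∣ M) (hMk : M ∣ k) (φ : MvPolynomial ι ℤ) (a : ι → ZMod M) :
    ‖∑ w : ι → ZMod k, if reduceVec hMk w = a then ZMod.stdAddChar (aeval w φ) else 0‖ ≤
      if ∀ i, aeval a (pderiv i φ) = 0 then
        (M : ℝ) ^ Fintype.card ι * √((R : ℝ) ^ Fintype.card ι * hessKer φ (reduceVec hRM a))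
      else 0 := by
  set N := Fintype.card ι with hN
  set B : ℝ := if ∀ i, aeval a (pderiv i φ) = 0 then
        (M : ℝ) ^ N * √((R : ℝ) ^ N * hessKer φ (reduceVec hRM a)) else 0 with hB
  set S := ∑ w : ι → ZMod k, if reduceVec hMk w = a then (ZMod.stdAddChar (aeval w φ) : ℂ) else 0
    with hS
  have hinner : ∀ w : ι → ZMod k, reduceVec hMk w = a →
      ‖∑ v : ι → ZMod k, (ZMod.stdAddChar (aeval (fun i => w i + (M : ZMod k) * v i) φ) : ℂ)‖ ≤
        (M : ℝ) ^ N * B := by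
    intro w hw
    by_cases hgrad : ∀ i, aeval a (pderiv i φ) = 0
    · have h1 := norm_shifted_sum_sq_le hk hRM (hRM.trans hMk) φ w
      rw [← reduceVec_reduceVec hMk hRM, hw] at h1
      rw [hB, if_pos hgrad]
      have hR : (0 : ℝ) < (R : ℝ) ^ N := by have := NeZero.pos R; positivity
      refine abs_le_of_sq_le_sq' ?_ (by positivity) |>.2
      refine le_of_mul_le_mul_right (h1.trans (le_of_eq ?_)) hR
      rw [mul_pow, mul_pow, Real.sq_sqrt (by positivity), hk]
      push_cast
      ring
    · obtain ⟨i, hi⟩ := not_forall.1 hgrad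
      have hne : ((M * R : ℕ) : ZMod k) * aeval w (pderiv i φ) ≠ 0 := by
        have : NeZero (M * R) := ⟨mul_ne_zero (NeZero.ne M) (NeZero.ne R)⟩
        rw [Ne, natCast_mul_eq_zero_iff_castHom (b := M * R) (c := M) (by rw [hk]; ring) hMk,
          ← aeval_reduceVec, hw]
        exact hi
      rw [shifted_sum_eq_zero (by rw [hk]; ring) φ w hne, hB, if_neg hgrad]
      simp
  -- The residue class of a is stable under translation by Mv. Averaging over all v modulo k turns S
  -- into an average of the shifted sums bounded in `hinner`, without parametrizing the class.
  have htrans : ∀ v : ι → ZMod k, S = ∑ w : ι → ZMod k, if reduceVec hMk w = a then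
      (ZMod.stdAddChar (aeval (fun i => w i + (M : ZMod k) * v i) φ) : ℂ) else 0 := by
    intro v
    rw [hS, ← Equiv.sum_comp (Equiv.addRight (fun i => (M : ZMod k) * v i))]
    refine sum_congr rfl fun w _ => ?_
    have h0 : reduceVec hMk (fun i => (M : ZMod k) * v i) = 0 := by
      funext i
      rw [reduceVec_apply, map_mul, map_natCast, ZMod.natCast_self, zero_mul, Pi.zero_apply]
    simp only [Equiv.coe_addRight, map_add, h0, add_zero]
    rfl
  have hsum : ((k ^ N : ℕ) : ℂ) * S = ∑ w : ι → ZMod k, if reduceVec hMk w = a then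
      ∑ v : ι → ZMod k, (ZMod.stdAddChar (aeval (fun i => w i + (M : ZMod k) * v i) φ) : ℂ)
        else 0 := by
    have h1 : ((k ^ N : ℕ) : ℂ) * S = ∑ _v : ι → ZMod k, S := by
      simp [hN, ZMod.card]
    rw [h1, sum_congr rfl fun v _ => htrans v, sum_comm]
    refine sum_congr rfl fun w _ => ?_
    split_ifs <;> simp
  have hcount : M ^ N * #{w : ι → ZMod k | reduceVec hMk w = a} = k ^ N := by
    have := card_filter_comp_surjective (reduceVec (ι := ι) hMk) (reduceVec_surjective hMk)
      (fun b => b = a)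
    have h1 : #{b : ι → ZMod M | b = a} = 1 := card_eq_one.2 ⟨a, by ext b; simp⟩
    rw [h1] at this
    simpa [ZMod.card] using this
  have hle : (k : ℝ) ^ N * ‖S‖ ≤ (k : ℝ) ^ N * B := by
    calc (k : ℝ) ^ N * ‖S‖ = ‖((k ^ N : ℕ) : ℂ) * S‖ := by
          rw [norm_mul, Complex.norm_natCast]; push_cast; rfl
      _ ≤ ∑ w : ι → ZMod k, if reduceVec hMk w = a then (M : ℝ) ^ N * B else 0 := by
          rw [hsum]
          refine (norm_sum_le _ _).trans (sum_le_sum fun w _ => ?_)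
          split_ifs with hw
          · exact hinner w hw
          · simp
      _ = (M ^ N * #{w : ι → ZMod k | reduceVec hMk w = a} : ℕ) * B := by
          rw [← sum_filter, sum_const, nsmul_eq_mul]
          push_cast
          ring
      _ = (k : ℝ) ^ N * B := by rw [hcount]; push_cast; rfl
  exact le_of_mul_le_mul_left hle (by have := NeZero.pos k; positivity)

/-- **Stationary phase** for exponential sums modulo `k = M ^ 2 * R` with `R ∣ M`. -/
theorem norm_sum_le_stationary {k M R : ℕ} [NeZero k] [NeZero M] [NeZero R] (hk : k = M ^ 2 * R)
    (hRM : R ∣ M) (hMk : M ∣ k) (φ : MvPolynomial ι ℤ) (A : (ι → ZMod M) → Prop) [DecidablePred A] :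
    ‖∑ w : ι → ZMod k, if A (reduceVec hMk w) then ZMod.stdAddChar (aeval w φ) else 0‖ ≤
      ∑ a : ι → ZMod M, if A a ∧ ∀ i, aeval a (pderiv i φ) = 0 then
        (M : ℝ) ^ Fintype.card ι * √((R : ℝ) ^ Fintype.card ι * hessKer φ (reduceVec hRM a))
      else 0 := by
  have : (∑ w : ι → ZMod k, if A (reduceVec hMk w) then (ZMod.stdAddChar (aeval w φ) : ℂ) else 0) =
      ∑ a : ι → ZMod M, if A a then ∑ w : ι → ZMod k,
        (if reduceVec hMk w = a then ZMod.stdAddChar (aeval w φ) else 0) else 0 := by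
    have h1 : ∀ w : ι → ZMod k,
        (if A (reduceVec hMk w) then (ZMod.stdAddChar (aeval w φ) : ℂ) else 0) =
        ∑ a : ι → ZMod M, if reduceVec hMk w = a then
          (if A a then ZMod.stdAddChar (aeval w φ) else 0) else 0 := by
      intro w
      rw [Finset.sum_ite_eq]
      simp
    rw [sum_congr rfl fun w _ => h1 w, sum_comm]
    refine sum_congr rfl fun a _ => ?_
    split_ifs <;> simp
  rw [this]
  refine (norm_sum_le _ _).trans (sum_le_sum fun a _ => ?_)
  by_cases hA : A a
  · simp only [hA, if_true, true_and]
    exact norm_fiber_sum_le hk hRM hMk φ a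
  · simp [hA]

end StationaryPhaseBound

/-! ### The sum Q as a sum in n + 2 variables, and derivatives of its phase -/

section ExpSum
open Finset
open scoped Classical

theorem expMod_eq_stdAddChar {k : ℕ} [NeZero k] (a : ℤ) :
    expMod k a = ZMod.stdAddChar (a : ZMod k) := by
  rw [expMod, ZMod.stdAddChar_coe]

theorem sum_range_coprime_eq {k : ℕ} [NeZero k] {α : Type*} [AddCommMonoid α] (g : ZMod k → α) :
    ∑ h ∈ (Finset.range k).filter (fun h => Nat.Coprime h k), g (h : ZMod k) =
      ∑ h : ZMod k, if IsUnit h then g h else 0 := by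
  rw [← sum_filter]
  refine sum_nbij' (fun h => (h : ZMod k)) (fun z => z.val) ?_ ?_ ?_ ?_ ?_
  · intro h hh
    simp only [mem_filter, mem_univ, true_and, mem_range] at hh ⊢
    exact (ZMod.isUnit_iff_coprime h k).2 hh.2
  · intro z hz
    simp only [mem_filter, mem_univ, true_and, mem_range] at hz ⊢
    refine ⟨ZMod.val_lt z, ?_⟩
    rw [← ZMod.isUnit_iff_coprime, ZMod.natCast_zmod_val]
    exact hz
  · intro h hh
    simp only [mem_filter, mem_range] at hh
    exact ZMod.val_cast_of_lt hh.1
  · intro z _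
    exact ZMod.natCast_zmod_val z
  · intro h _
    rfl

theorem sum_fin_vec_eq {k N : ℕ} [NeZero k] {α : Type*} [AddCommMonoid α]
    (g : (Fin N → ZMod k) → α) :
    ∑ l : Fin N → Fin k, g (fun i => ((l i : ℕ) : ZMod k)) = ∑ l : Fin N → ZMod k, g l := by
  have hbij : Function.Bijective (fun x : Fin k => ((x : ℕ) : ZMod k)) := by
    refine ⟨fun x y hxy => ?_, fun z => ⟨⟨z.val, ZMod.val_lt z⟩, ZMod.natCast_zmod_val z⟩⟩
    have := congrArg ZMod.val hxy
    simp only [ZMod.val_cast_of_lt x.2, ZMod.val_cast_of_lt y.2] at this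
    exact Fin.ext this
  exact Equiv.sum_comp (Equiv.piCongrRight fun _ : Fin N => Equiv.ofBijective _ hbij) g

/-- The phase `h f(l) + m.l`, as a polynomial in the variables `h` (indexed by `none`) and `l`. -/
noncomputable def phase {n : ℕ} (C : MvPolynomial (Fin n) ℤ) (m : Fin (n + 1) → ℤ) :
    MvPolynomial (Option (Fin (n + 1))) ℤ :=
  X none * rename some (cubicMinusSquare C) + ∑ i, MvPolynomial.C (m i) * X (some i)

/-- Treating h as one more variable puts Q into the shape required by stationary phase; the
coprimality of h and k survives as a condition on residue classes. -/
theorem expSumQ_eq {n : ℕ} (C : MvPolynomial (Fin n) ℤ) (m : Fin (n + 1) → ℤ) {k : ℕ} [NeZero k] :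
    expSumQ C m k = ∑ w : Option (Fin (n + 1)) → ZMod k,
      if IsUnit (w none) then ZMod.stdAddChar (aeval w (phase C m)) else 0 := by
  have h1 : expSumQ C m k = ∑ h ∈ (Finset.range k).filter (fun h => Nat.Coprime h k),
      ∑ l : Fin (n + 1) → ZMod k, (ZMod.stdAddChar ((h : ZMod k) * aeval l (cubicMinusSquare C) +
        ∑ i, (m i : ZMod k) * l i) : ℂ) := by
    rw [expSumQ]
    refine sum_congr rfl fun h _ => ?_
    rw [← sum_fin_vec_eq]
    refine sum_congr rfl fun l _ => ?_
    rw [expMod_eq_stdAddChar]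
    congr 1
    push_cast
    congr 2
    have := MvPolynomial.eval₂_comp_left (Int.castRingHom (ZMod k)) (RingHom.id ℤ)
      (fun i => ((l i : ℕ) : ℤ)) (cubicMinusSquare C)
    rw [MvPolynomial.aeval_def]
    refine Eq.trans this ?_
    congr 1
    funext i
    simp
  rw [h1, sum_range_coprime_eq (fun h => ∑ l : Fin (n + 1) → ZMod k,
    (ZMod.stdAddChar (h * aeval l (cubicMinusSquare C) + ∑ i, (m i : ZMod k) * l i) : ℂ)),
    ← Equiv.sum_comp (Equiv.piOptionEquivProd (β := fun _ : Option (Fin (n + 1)) => ZMod k)).symm,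
    Fintype.sum_prod_type]
  refine sum_congr rfl fun h _ => ?_
  have h2 : ∀ l : Fin (n + 1) → ZMod k, aeval ((Equiv.piOptionEquivProd
      (β := fun _ : Option (Fin (n + 1)) => ZMod k)).symm (h, l)) (phase C m) =
      h * aeval l (cubicMinusSquare C) + ∑ i, (m i : ZMod k) * l i := by
    intro l
    rw [phase, map_add, map_mul, aeval_X, aeval_rename, map_sum]
    refine congrArg₂ _ rfl (sum_congr rfl fun i _ => ?_)
    rw [map_mul, aeval_X, aeval_C]
    rfl
  simp_rw [h2]
  split_ifs with hh
  · exact sum_congr rfl fun l _ => (if_pos hh).symm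
  · exact (sum_eq_zero fun l _ => if_neg hh).symm

/-- The moduli k and M have the same prime factors, so being a unit depends only on the class modulo
M. -/
theorem isUnit_castHom_iff {k M : ℕ} [NeZero k] (hMk : M ∣ k) (hkM : k ∣ M ^ 3) (z : ZMod k) :
    IsUnit (ZMod.castHom hMk (ZMod M) z) ↔ IsUnit z := by
  rw [← ZMod.natCast_zmod_val z, map_natCast, ZMod.isUnit_iff_coprime, ZMod.isUnit_iff_coprime]
  constructor
  · intro h
    exact Nat.Coprime.coprime_dvd_right hkM (h.pow_right 3)
  · exact fun h => h.coprime_dvd_right hMk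

theorem pderiv_none_rename_some {σ : Type*} (p : MvPolynomial σ ℤ) :
    pderiv none (rename some p) = 0 := by
  refine pderiv_eq_zero_of_notMem_vars fun h => ?_
  have := vars_rename (some : σ → Option σ) p h
  simp at this

section Derivatives

variable {n : ℕ} (C : MvPolynomial (Fin n) ℤ) (m : Fin (n + 1) → ℤ)

theorem pderiv_none_phase : pderiv none (phase C m) = rename some (cubicMinusSquare C) := by
  rw [phase, map_add, pderiv_mul, pderiv_none_rename_some, map_sum]
  simp [pderiv_X]

theorem pderiv_some_phase (i : Fin (n + 1)) : pderiv (some i) (phase C m) =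
    X none * rename some (pderiv i (cubicMinusSquare C)) + MvPolynomial.C (m i) := by
  rw [phase, map_add, pderiv_mul, pderiv_rename (Option.some_injective _), map_sum]
  simp [pderiv_X, Pi.single_apply]

theorem pderiv_some_pderiv_some_phase (i j : Fin (n + 1)) :
    pderiv (some i) (pderiv (some j) (phase C m)) =
    X none * rename some (pderiv i (pderiv j (cubicMinusSquare C))) := by
  rw [pderiv_some_phase, map_add, pderiv_mul, pderiv_rename (Option.some_injective _)]
  simp

theorem pderiv_castSucc_cubicMinusSquare (i : Fin n) :
    pderiv i.castSucc (cubicMinusSquare C) = rename Fin.castSucc (pderiv i C) := by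
  rw [cubicMinusSquare, map_sub, pderiv_rename (Fin.castSucc_injective n), pderiv_pow,
    pderiv_X_of_ne (Fin.castSucc_lt_last i).ne']
  simp

theorem pderiv_last_rename (p : MvPolynomial (Fin n) ℤ) :
    pderiv (Fin.last n) (rename Fin.castSucc p) = 0 := by
  refine pderiv_eq_zero_of_notMem_vars fun h => ?_
  have := vars_rename Fin.castSucc p h
  simp only [mem_image] at this
  obtain ⟨i, _, hi⟩ := this
  exact (Fin.castSucc_lt_last i).ne hi

theorem pderiv_last_cubicMinusSquare :
    pderiv (Fin.last n) (cubicMinusSquare C) = - (2 * X (Fin.last n)) := by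
  rw [cubicMinusSquare, map_sub, pderiv_last_rename, pderiv_pow, pderiv_X_self]
  simp

end Derivatives

end ExpSum

/-! ### From Q to a weighted count of zeros of 2C -/

section ExpSumBound
open Finset
open scoped Classical

variable {n : ℕ}

theorem pderiv_two {σ : Type*} (i : σ) : pderiv i (2 : MvPolynomial σ ℤ) = 0 := by
  exact_mod_cast (pderiv i).map_natCast 2

theorem hessMul_sub {ι S : Type*} [Fintype ι] [CommRing S] (φ : MvPolynomial ι ℤ) (a d d' : ι → S)
    (i : ι) : hessMul φ a (d - d') i = hessMul φ a d i - hessMul φ a d' i := by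
  simp only [hessMul, Pi.sub_apply, mul_sub, sum_sub_distrib]

theorem card_two_mul_eq_zero_le (R : ℕ) [NeZero R] : #{x : ZMod R | 2 * x = 0} ≤ 2 := by
  have hpos := NeZero.pos R
  have hsub : ({x : ZMod R | 2 * x = 0} : Finset (ZMod R)) ⊆ {0, ((R / 2 : ℕ) : ZMod R)} := by
    intro x hx
    simp only [mem_filter, mem_univ, true_and, mem_insert, mem_singleton] at hx ⊢
    have h1 : ((2 * x.val : ℕ) : ZMod R) = 0 := by
      push_cast
      rw [ZMod.natCast_zmod_val]
      exact hx
    rw [ZMod.natCast_eq_zero_iff] at h1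
    obtain ⟨c, hc⟩ := h1
    have hlt := ZMod.val_lt x
    have hc2 : c < 2 := by
      by_contra h
      have : R * 2 ≤ R * c := Nat.mul_le_mul_left R (not_lt.1 h)
      omega
    interval_cases c
    · left
      have : x.val = 0 := by omega
      exact (ZMod.val_eq_zero x).1 this
    · right
      have : R / 2 = x.val := by omega
      rw [this, ZMod.natCast_zmod_val]
  exact (card_le_card hsub).trans card_le_two

theorem hessMul_phase_some_castSucc {R : ℕ} (C : MvPolynomial (Fin n) ℤ) (m : Fin (n + 1) → ℤ)
    (a d : Option (Fin (n + 1)) → ZMod R) (i : Fin n) (hd : d none = 0) :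
    hessMul (phase C m) a d (some i.castSucc) =
      a none * hessMul C (fun i => a (some i.castSucc)) (fun i => d (some i.castSucc)) i := by
  rw [hessMul, Fintype.sum_option, hd, mul_zero, zero_add, Fin.sum_univ_castSucc]
  have h0 : pderiv i.castSucc (pderiv (Fin.last n) (cubicMinusSquare C)) = 0 := by
    rw [pderiv_last_cubicMinusSquare, map_neg, pderiv_mul,
      pderiv_X_of_ne (Fin.castSucc_lt_last i).ne']
    simp [pderiv_two]
  rw [pderiv_some_pderiv_some_phase C m i.castSucc (Fin.last n), h0]
  simp only [map_zero, mul_zero, zero_mul, add_zero, hessMul, mul_sum]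
  refine sum_congr rfl fun j _ => ?_
  rw [pderiv_some_pderiv_some_phase, pderiv_castSucc_cubicMinusSquare,
    pderiv_rename (Fin.castSucc_injective n), map_mul, aeval_X, aeval_rename, aeval_rename, mul_assoc]
  rfl

theorem hessMul_phase_some_last {R : ℕ} (C : MvPolynomial (Fin n) ℤ) (m : Fin (n + 1) → ℤ)
    (a d : Option (Fin (n + 1)) → ZMod R) (hd : d none = 0) :
    hessMul (phase C m) a d (some (Fin.last n)) = - (a none * (2 * d (some (Fin.last n)))) := by
  rw [hessMul, Fintype.sum_option, hd, mul_zero, zero_add, Fin.sum_univ_castSucc]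
  have h0 : ∀ j : Fin n, pderiv (Fin.last n) (pderiv j.castSucc (cubicMinusSquare C)) = 0 := by
    intro j
    rw [pderiv_castSucc_cubicMinusSquare, pderiv_last_rename]
  have h1 : pderiv (Fin.last n) (pderiv (Fin.last n) (cubicMinusSquare C)) = -2 := by
    rw [pderiv_last_cubicMinusSquare, map_neg, pderiv_mul, pderiv_X_self]
    simp [pderiv_two]
  simp only [pderiv_some_pderiv_some_phase, h0, h1]
  simp only [map_mul, map_neg, map_zero, map_ofNat, aeval_X, mul_zero, zero_mul, sum_const_zero]
  ring

theorem card_le_card_mul_card_fiber {G H : Type*} [AddCommGroup G] [AddCommGroup H] [Fintype H]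
    [DecidableEq H] (K : Finset G) (f : G → H) (hf : ∀ x y, f (x - y) = f x - f y)
    (hK : ∀ x y, x ∈ K → y ∈ K → x - y ∈ K) :
    #K ≤ Fintype.card H * #{x ∈ K | f x = 0} := by
  have hfib : ∀ c : H, #{d ∈ K | f d = c} ≤ #{d ∈ K | f d = 0} := by
    intro c
    rcases ({d ∈ K | f d = c} : Finset _).eq_empty_or_nonempty with h | ⟨d₀, hd₀⟩
    · rw [h]; simp
    · simp only [mem_filter] at hd₀
      refine card_le_card_of_injOn (fun d => d - d₀) ?_ ?_
      · intro d hd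
        simp only [coe_filter, Set.mem_ofPred_eq] at hd ⊢
        exact ⟨hK _ _ hd.1 hd₀.1, by rw [hf, hd.2, hd₀.2, sub_self]⟩
      · intro d _ d' _ h
        exact sub_left_injective h
  calc #K = ∑ c : H, #{d ∈ K | f d = c} :=
        card_eq_sum_card_fiberwise (f := f) (t := univ) (by simp)
    _ ≤ ∑ _c : H, #{d ∈ K | f d = 0} := sum_le_sum fun c _ => hfib c
    _ = _ := by simp

/-- The kernel is a group, so restricting to vectors with zero h-component costs at most a factor R.
On these the Hessian splits into the unit h times that of C and times -2, the latter having at most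
two solutions. -/
theorem hessKer_phase_le {R : ℕ} [NeZero R] (C : MvPolynomial (Fin n) ℤ) (m : Fin (n + 1) → ℤ)
    (a : Option (Fin (n + 1)) → ZMod R) (ha : IsUnit (a none)) :
    hessKer (phase C m) a ≤ R * (hessKer C (fun i => a (some i.castSucc)) * 2) := by
  obtain ⟨K, hK, hmem⟩ : ∃ K : Finset (Option (Fin (n + 1)) → ZMod R),
      hessKer (phase C m) a = #K ∧ ∀ d, d ∈ K ↔ ∀ i, hessMul (phase C m) a d i = 0 :=
    ⟨_, rfl, by simp⟩
  rw [hK]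
  have h0 : #{d ∈ K | d none = 0} ≤ hessKer C (fun i => a (some i.castSucc)) * 2 := by
    refine le_trans ?_ (Nat.mul_le_mul_left _ (card_two_mul_eq_zero_le R))
    rw [hessKer, ← card_product]
    refine card_le_card_of_injOn (fun d => (fun i => d (some i.castSucc), d (some (Fin.last n)))) ?_ ?_
    · intro d hd
      simp only [coe_filter, Set.mem_ofPred_eq, hmem] at hd
      simp only [coe_product, coe_filter, mem_univ, true_and, Set.mem_prod, Set.mem_ofPred_eq]
      refine ⟨fun i => ?_, ?_⟩
      · have := hd.1 (some i.castSucc)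
        rw [hessMul_phase_some_castSucc C m a d i hd.2] at this
        exact (ha.mul_right_eq_zero).1 this
      · have := hd.1 (some (Fin.last n))
        rw [hessMul_phase_some_last C m a d hd.2, neg_eq_zero] at this
        exact (ha.mul_right_eq_zero).1 this
    · intro d hd d' hd' h
      simp only [coe_filter, Set.mem_ofPred_eq] at hd hd'
      simp only [Prod.mk.injEq] at h
      funext o
      rcases o with _ | i
      · rw [hd.2, hd'.2]
      · induction i using Fin.lastCases with
        | last => exact h.2
        | cast i => exact congrFun h.1 i
  calc #K ≤ Fintype.card (ZMod R) * #{d ∈ K | d none = 0} :=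
        card_le_card_mul_card_fiber K (fun d => d none) (fun d d' => rfl) fun d d' hd hd' => by
          rw [hmem] at hd hd' ⊢
          intro i
          rw [hessMul_sub, hd i, hd' i, sub_zero]
    _ ≤ R * (hessKer C (fun i => a (some i.castSucc)) * 2) := by
        rw [ZMod.card]
        exact Nat.mul_le_mul_left _ h0

theorem hessKer_le_hessKer_C_mul {ι : Type*} [Fintype ι] [DecidableEq ι] {R : ℕ} [NeZero R] (c : ℤ)
    (F : MvPolynomial ι ℤ) (a : ι → ZMod R) : hessKer F a ≤ hessKer (MvPolynomial.C c * F) a := by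
  refine card_le_card fun d hd => ?_
  simp only [mem_filter, mem_univ, true_and] at hd ⊢
  intro i
  have := hd i
  rw [hessMul] at this ⊢
  simp only [pderiv_C_mul, map_mul, aeval_C, mul_assoc]
  rw [← mul_sum, this, mul_zero]

/-- The zeros of `F` modulo `M`, weighted by the square root of the size of the kernel of the
Hessian modulo `R`. -/
noncomputable def hessWeightedCount {ι : Type*} [Fintype ι] [DecidableEq ι] (F : MvPolynomial ι ℤ) {M R : ℕ}
    [NeZero M] [NeZero R] (hRM : R ∣ M) : ℝ :=
  ∑ u : ι → ZMod M, if aeval u F = 0 then √(hessKer F (reduceVec hRM u) : ℝ) else 0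

/-- With x the last variable, the h-derivative gives C(u) = x² and the x-derivative 2x = 0, since
the last frequency is zero; hence 2C(u) = 0. Passing to 2C avoids separating odd and even moduli. -/
theorem stationary_conditions {M : ℕ} (C : MvPolynomial (Fin n) ℤ) (m : Fin n → ℤ)
    (a : Option (Fin (n + 1)) → ZMod M) (ha : IsUnit (a none))
    (hgrad : ∀ i, aeval a (pderiv i (phase C (appendZero m))) = 0) :
    2 * a (some (Fin.last n)) = 0 ∧
    aeval (fun i => a (some i.castSucc)) (MvPolynomial.C 2 * C) = 0 ∧
    ∀ i, (m i : ZMod M) = -(a none * aeval (fun i => a (some i.castSucc)) (pderiv i C)) := by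
  have h1 : 2 * a (some (Fin.last n)) = 0 := by
    have := hgrad (some (Fin.last n))
    rw [pderiv_some_phase, pderiv_last_cubicMinusSquare, appendZero, Fin.snoc_last] at this
    simp only [map_mul, map_neg, aeval_X, rename_X, map_ofNat, map_zero, add_zero] at this
    rw [mul_neg, neg_eq_zero] at this
    exact (ha.mul_right_eq_zero).1 this
  refine ⟨h1, ?_, fun i => ?_⟩
  · have := hgrad none
    rw [pderiv_none_phase, aeval_rename, cubicMinusSquare, map_sub, aeval_rename, map_pow,
      aeval_X, sub_eq_zero] at this
    rw [map_mul, aeval_C]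
    have h2 : aeval (fun i : Fin n => a (some i.castSucc)) C = a (some (Fin.last n)) ^ 2 := this
    rw [h2]
    simp only [map_ofNat]
    linear_combination a (some (Fin.last n)) * h1
  · have := hgrad (some i.castSucc)
    rw [pderiv_some_phase, pderiv_castSucc_cubicMinusSquare, appendZero, Fin.snoc_castSucc,
      map_add, map_mul, aeval_X, aeval_rename, aeval_rename, aeval_C] at this
    exact eq_neg_of_add_eq_zero_right this

/-- Stationary phase in n + 2 variables supplies M^(n+2) and R^(n+2) under the root; the further 2R
there comes from `hessKer_phase_le`. The unit condition on h is then dropped. -/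
theorem norm_expSumQ_le {k M R : ℕ} [NeZero k] [NeZero M] [NeZero R] (hk : k = M ^ 2 * R)
    (hRM : R ∣ M) (C : MvPolynomial (Fin n) ℤ) (m : Fin n → ℤ) :
    ‖expSumQ C (appendZero m) k‖ ≤ (M : ℝ) ^ (n + 2) * √(2 * (R : ℝ) ^ (n + 3)) *
      ∑ a : Option (Fin (n + 1)) → ZMod M,
        if 2 * a (some (Fin.last n)) = 0 ∧
          aeval (fun i => a (some i.castSucc)) (MvPolynomial.C 2 * C) = 0 ∧
          ∀ i, (m i : ZMod M) = -(a none * aeval (fun i => a (some i.castSucc)) (pderiv i C))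
        then √(hessKer (MvPolynomial.C 2 * C) (reduceVec hRM fun i => a (some i.castSucc)) : ℝ)
        else 0 := by
  have hMk : M ∣ k := ⟨M * R, by rw [hk]; ring⟩
  have hkM : k ∣ M ^ 3 := by
    rw [hk, pow_succ M 2]
    exact mul_dvd_mul_left _ hRM
  have hQ := norm_sum_le_stationary hk hRM hMk (phase C (appendZero m)) (fun a => IsUnit (a none))
  have hcast : ∀ w : Option (Fin (n + 1)) → ZMod k,
      IsUnit (reduceVec hMk w none) ↔ IsUnit (w none) := fun w => isUnit_castHom_iff hMk hkM _
  rw [expSumQ_eq]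
  refine le_trans (le_of_eq ?_) (le_trans hQ ?_)
  · refine congrArg _ (sum_congr rfl fun w _ => ?_)
    exact if_congr (hcast w).symm rfl rfl
  rw [mul_sum]
  refine sum_le_sum fun a _ => ?_
  by_cases h : IsUnit (a none) ∧ ∀ i, aeval a (pderiv i (phase C (appendZero m))) = 0
  · rw [if_pos h, if_pos (stationary_conditions C m a h.1 h.2), mul_assoc,
      ← Real.sqrt_mul (by positivity)]
    simp only [Fintype.card_option, Fintype.card_fin]
    refine mul_le_mul_of_nonneg_left (Real.sqrt_le_sqrt ?_) (by positivity)
    have h1 : hessKer (phase C (appendZero m)) (reduceVec hRM a) ≤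
        R * (hessKer (MvPolynomial.C 2 * C) (reduceVec hRM fun i => a (some i.castSucc)) * 2) := by
      refine (hessKer_phase_le C (appendZero m) (reduceVec hRM a) (h.1.map (ZMod.castHom hRM (ZMod R)))).trans ?_
      gcongr
      exact hessKer_le_hessKer_C_mul 2 C _
    have h2 : (hessKer (phase C (appendZero m)) (reduceVec hRM a) : ℝ) ≤
        R * (hessKer (MvPolynomial.C 2 * C) (reduceVec hRM fun i => a (some i.castSucc)) * 2) := by
      exact_mod_cast h1
    calc _ ≤ (R : ℝ) ^ (n + 1 + 1) * (R * (hessKer (MvPolynomial.C 2 * C)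
          (reduceVec hRM fun i => a (some i.castSucc)) * 2)) := by gcongr
      _ = _ := by ring
  · rw [if_neg h]
    split_ifs
    · positivity
    · simp

/-- Interchange the sums: each critical point fixes m modulo M, whence B. Then h takes M values and
the last coordinate at most two, while the others make up the weighted count. -/
theorem sum_norm_expSumQ_le {k M R : ℕ} [NeZero k] [NeZero M] [NeZero R] (hk : k = M ^ 2 * R)
    (hRM : R ∣ M) (C : MvPolynomial (Fin n) ℤ) (s : Finset (Fin n → ℤ)) (B : ℝ)
    (hB : ∀ b : Fin n → ZMod M, (#{m ∈ s | ∀ i, (m i : ZMod M) = b i} : ℝ) ≤ B) :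
    ∑ m ∈ s, ‖expSumQ C (appendZero m) k‖ ≤ (M : ℝ) ^ (n + 2) * √(2 * (R : ℝ) ^ (n + 3)) *
      (B * (2 * M * hessWeightedCount (MvPolynomial.C 2 * C) hRM)) := by
  have hB0 : 0 ≤ B := (Nat.cast_nonneg _).trans (hB 0)
  refine (sum_le_sum fun m _ => norm_expSumQ_le hk hRM C m).trans ?_
  rw [← mul_sum, sum_comm]
  refine mul_le_mul_of_nonneg_left ?_ (by positivity)
  set W : (Fin n → ZMod M) → ℝ := fun u => if aeval u (MvPolynomial.C 2 * C) = 0 then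
    √(hessKer (MvPolynomial.C 2 * C) (reduceVec hRM u) : ℝ) else 0 with hW
  have hW0 : ∀ u, 0 ≤ W u := fun u => by simp only [hW]; positivity
  have h1 : ∀ a : Option (Fin (n + 1)) → ZMod M, (∑ m ∈ s,
        if 2 * a (some (Fin.last n)) = 0 ∧
          aeval (fun i => a (some i.castSucc)) (MvPolynomial.C 2 * C) = 0 ∧
          ∀ i, (m i : ZMod M) = -(a none * aeval (fun i => a (some i.castSucc)) (pderiv i C))
        then √(hessKer (MvPolynomial.C 2 * C) (reduceVec hRM fun i => a (some i.castSucc)) : ℝ)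
        else 0) ≤
        B * ((if 2 * a (some (Fin.last n)) = 0 then 1 else 0) * W (fun i => a (some i.castSucc))) := by
    intro a
    simp only [hW]
    by_cases h2 : 2 * a (some (Fin.last n)) = 0
    · by_cases h3 : aeval (fun i => a (some i.castSucc)) (MvPolynomial.C 2 * C) = 0
      · simp only [h2, h3, true_and, if_true, one_mul]
        rw [← sum_filter, sum_const, nsmul_eq_mul]
        gcongr
        exact hB fun i => -(a none * aeval (fun i => a (some i.castSucc)) (pderiv i C))
      · rw [if_neg h3, sum_eq_zero fun m _ => if_neg fun h => h3 h.2.1, mul_zero, mul_zero]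
    · rw [if_neg h2, sum_eq_zero fun m _ => if_neg fun h => h2 h.1, zero_mul, mul_zero]
  refine (sum_le_sum fun a _ => h1 a).trans ?_
  rw [← mul_sum]
  refine mul_le_mul_of_nonneg_left ?_ hB0
  rw [← Equiv.sum_comp (Equiv.piOptionEquivProd (β := fun _ : Option (Fin (n + 1)) => ZMod M)).symm,
    Fintype.sum_prod_type]
  have h2 : ∀ h : ZMod M, ∑ l : Fin (n + 1) → ZMod M,
      ((if 2 * l (Fin.last n) = 0 then 1 else 0) * W (fun i => l i.castSucc) : ℝ) =
      #{x : ZMod M | 2 * x = 0} * ∑ u, W u := by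
    intro h
    rw [← Equiv.sum_comp (Fin.snocEquiv fun _ : Fin (n + 1) => ZMod M), Fintype.sum_prod_type]
    simp only [Fin.snocEquiv_apply, Fin.snoc_last, Fin.snoc_castSucc]
    rw [← sum_mul_sum]
    simp
  calc _ = ∑ h : ZMod M, ∑ l : Fin (n + 1) → ZMod M,
      ((if 2 * l (Fin.last n) = 0 then 1 else 0) * W (fun i => l i.castSucc) : ℝ) := rfl
    _ = M * (#{x : ZMod M | 2 * x = 0} * ∑ u, W u) := by
      rw [sum_congr rfl fun h _ => h2 h]
      simp [ZMod.card]
    _ ≤ M * (2 * ∑ u, W u) := by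
      have : (#{x : ZMod M | 2 * x = 0} : ℝ) ≤ 2 := by exact_mod_cast card_two_mul_eq_zero_le M
      have h0 : 0 ≤ ∑ u, W u := sum_nonneg fun u _ => hW0 u
      gcongr
    _ = 2 * M * ∑ u, W u := by ring
    _ = 2 * M * hessWeightedCount (MvPolynomial.C 2 * C) hRM := rfl

end ExpSumBound

/-! ### An integral Nullstellensatz for the gradient -/

section Nullstellensatz

variable {n : ℕ}

theorem homogeneousComponent_add_mul {σ R : Type*} [CommSemiring R] (N d : ℕ)
    (c f : MvPolynomial σ R) (hf : f.IsHomogeneous d) :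
    homogeneousComponent (N + d) (c * f) = homogeneousComponent N c * f := by
  conv_lhs => rw [← sum_homogeneousComponent c, Finset.sum_mul, map_sum]
  have h : ∀ i, homogeneousComponent (N + d) (homogeneousComponent i c * f) =
      if N = i then homogeneousComponent i c * f else 0 := by
    intro i
    rw [homogeneousComponent_of_mem (n := i + d)
      ((mem_homogeneousSubmodule _ _).2 ((homogeneousComponent_isHomogeneous i c).mul hf))]
    simp
  simp_rw [h]
  rw [Finset.sum_ite_eq]
  split_ifs with hN
  · rfl
  · rw [homogeneousComponent_eq_zero _ _ (by simpa [Nat.lt_succ_iff] using hN), zero_mul]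

theorem exists_C_mul_eq_map {σ : Type*} (q : MvPolynomial σ ℚ) :
    ∃ D : ℤ, D ≠ 0 ∧ ∃ p : MvPolynomial σ ℤ, map (Int.castRingHom ℚ) p = C (D : ℚ) * q := by
  induction q using MvPolynomial.induction_on with
  | C a =>
    refine ⟨a.den, by exact_mod_cast a.den_nz, C a.num, ?_⟩
    rw [map_C, ← C_mul]
    congr 1
    simp [mul_comm, Rat.mul_den_eq_num]
  | add p q hp hq =>
    obtain ⟨D, hD, p', hp'⟩ := hp
    obtain ⟨E, hE, q', hq'⟩ := hq
    refine ⟨D * E, mul_ne_zero hD hE, C E * p' + C D * q', ?_⟩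
    simp only [map_add, map_mul, map_C, hp', hq', Int.coe_castRingHom, Int.cast_mul]
    ring
  | mul_X p i hp =>
    obtain ⟨D, hD, p', hp'⟩ := hp
    refine ⟨D, hD, p' * X i, ?_⟩
    rw [map_mul, hp', map_X, mul_assoc]

theorem exists_common_C_mul_eq_map {σ κ : Type*} [Fintype κ] (q : κ → MvPolynomial σ ℚ) :
    ∃ D : ℤ, D ≠ 0 ∧ ∃ p : κ → MvPolynomial σ ℤ,
      ∀ j, map (Int.castRingHom ℚ) (p j) = C (D : ℚ) * q j := by
  classical
  choose D hD p hp using fun j => exists_C_mul_eq_map (q j)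
  refine ⟨∏ j, D j, Finset.prod_ne_zero_iff.2 fun j _ => hD j,
    fun j => C (∏ l ∈ Finset.univ.erase j, D l) * p j, fun j => ?_⟩
  rw [map_mul, hp, map_C, ← mul_assoc, ← C_mul, ← Finset.prod_erase_mul _ _ (Finset.mem_univ j)]
  push_cast
  simp

/-- For a non-singular cubic form, a multiple of a power of every variable lies in the ideal of the
partial derivatives, over `ℤ`. -/
theorem exists_pow_mem_gradient_ideal {F : MvPolynomial (Fin n) ℤ} (hF : F.IsHomogeneous 3)
    (hns : NonsingularForm F) :
    ∃ D : ℤ, D ≠ 0 ∧ ∃ N : ℕ, ∃ g : Fin n → Fin n → MvPolynomial (Fin n) ℤ,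
      (∀ i j, (g i j).IsHomogeneous N) ∧
        ∀ i, C D * X i ^ (N + 2) = ∑ j, g i j * pderiv j F := by
  set f : Fin n → MvPolynomial (Fin n) ℚ := fun j => map (Int.castRingHom ℚ) (pderiv j F) with hf
  set I := Ideal.span (Set.range f) with hI
  have hX : ∀ i, X i ∈ I.radical := by
    intro i
    rw [← vanishingIdeal_zeroLocus_eq_radical (K := ℂ), mem_vanishingIdeal_iff]
    intro x hx
    rw [hI, zeroLocus_span] at hx
    have h0 : x = 0 := by
      refine hns x fun j => ?_
      have := hx (f j) ⟨j, rfl⟩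
      exact (aeval_map_algebraMap ℚ x (pderiv j F)).symm.trans this
    simp [h0]
  choose e he using hX
  -- Any common exponent at least every e i serves; the extra 2 in N + 2 is the degree of the
  -- partial derivatives.
  set N := ∑ i, e i with hN
  have hmem : ∀ i, X i ^ (N + 2) ∈ I := fun i =>
    I.pow_mem_of_pow_mem (he i)
      ((Finset.single_le_sum (fun _ _ => Nat.zero_le _) (Finset.mem_univ i)).trans
        (Nat.le_add_right _ 2))
  choose c hc using fun i => Ideal.mem_span_range_iff_exists_fun.1 (hmem i)
  obtain ⟨D, hD, p, hp⟩ := exists_common_C_mul_eq_map (fun ij : Fin n × Fin n => c ij.1 ij.2)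
  refine ⟨D, hD, N, fun i j => homogeneousComponent N (p (i, j)),
    fun i j => homogeneousComponent_isHomogeneous _ _, fun i => ?_⟩
  have hid : C D * X i ^ (N + 2) = ∑ j, p (i, j) * pderiv j F := by
    apply map_injective (Int.castRingHom ℚ) Int.cast_injective
    simp only [map_mul, map_pow, map_X, map_C, map_sum, hp]
    rw [← hc i, Finset.mul_sum]
    simp only [Int.coe_castRingHom, mul_assoc, hf]
  -- As the partial derivatives are quadratic, the degree N + 2 part of the identity only involves
  -- the degree N parts of the coefficients. This degree control drives the Bézout count.
  have hcomp := congrArg (homogeneousComponent (N + 2)) hid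
  rw [map_sum, homogeneousComponent_of_mem (n := N + 2), if_pos rfl] at hcomp
  · rw [hcomp]
    exact Finset.sum_congr rfl fun j _ => homogeneousComponent_add_mul N 2 _ _ hF.pderiv
  · exact (mem_homogeneousSubmodule _ _).2 (isHomogeneous_C_mul_X_pow _ _ _)

end Nullstellensatz

/-! ### A Bézout bound by linear algebra on the solution set -/

section Bezout
open Finset
open scoped Classical

variable {n : ℕ} {K : Type*} [Field K] [Fintype K]

/-- A Bézout type bound: if every `X i ^ (N + 2)` lies in the ideal generated by the `G j`, with
coefficients of degree at most `N`, then the equations `G j = L j` with `L j` of degree at most one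
have at most `(N + 2) ^ n` solutions. -/
theorem card_solutions_le {N : ℕ} (G L : Fin n → MvPolynomial (Fin n) K)
    (g : Fin n → Fin n → MvPolynomial (Fin n) K) (hg : ∀ i j, (g i j).totalDegree ≤ N)
    (hL : ∀ j, (L j).totalDegree ≤ 1) (hid : ∀ i, X i ^ (N + 2) = ∑ j, g i j * G j) :
    #{u : Fin n → K | ∀ j, eval u (G j) = eval u (L j)} ≤ (N + 2) ^ n := by
  set V := {u : Fin n → K // ∀ j, eval u (G j) = eval u (L j)} with hV
  let r : MvPolynomial (Fin n) K →ₗ[K] (V → K) :=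
    { toFun := fun p u => eval u.1 p
      map_add' := fun p q => by funext u; simp
      map_smul' := fun a p => by funext u; simp [smul_eval] }
  have hr : ∀ p u, r p u = eval u.1 p := fun p u => rfl
  -- The (N + 2) ^ n monomials with all exponents below N + 2 will be shown to span the functions on
  -- V.
  let b : (Fin n → Fin (N + 2)) → (V → K) :=
    fun s => r (monomial (Finsupp.equivFunOnFinite.symm fun i => (s i : ℕ)) 1)
  set W := Submodule.span K (Set.range b) with hW
  have hmon : ∀ d : ℕ, ∀ s : Fin n →₀ ℕ, s.degree = d → r (monomial s 1) ∈ W := by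
    intro d
    induction d using Nat.strong_induction_on with
    | _ d ih =>
      have hpoly : ∀ p : MvPolynomial (Fin n) K, p.totalDegree < d → r p ∈ W := by
        intro p hp
        rw [p.as_sum, map_sum]
        refine W.sum_mem fun s hs => ?_
        have h1 : monomial s (coeff s p) = coeff s p • monomial s (1 : K) := by
          rw [smul_monomial, smul_eq_mul, mul_one]
        rw [h1, map_smul]
        refine W.smul_mem _ (ih s.degree (lt_of_le_of_lt ?_ hp) s rfl)
        rw [Finsupp.degree]
        exact le_totalDegree hs
      intro s hs
      by_cases hall : ∀ i, s i < N + 2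
      · refine Submodule.subset_span ⟨fun i => ⟨s i, hall i⟩, ?_⟩
        simp only [b]
        congr 2
        ext i
        simp
      · obtain ⟨i, hi⟩ := not_forall.1 hall
        rw [not_lt] at hi
        obtain ⟨t, ht⟩ : ∃ t, s = Finsupp.single i (N + 2) + t :=
          ⟨s - Finsupp.single i (N + 2), (add_tsub_cancel_of_le (Finsupp.single_le_iff.2 hi)).symm⟩
        have hdeg : t.degree + (N + 2) = d := by
          rw [← hs, ht, map_add, Finsupp.degree_single, add_comm]
        have h1 : r (monomial s 1) = r ((∑ j, g i j * L j) * monomial t 1) := by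
          have h2 : monomial s (1 : K) = (∑ j, g i j * G j) * monomial t 1 := by
            rw [← hid, X_pow_eq_monomial, monomial_mul, ht, mul_one]
          funext u
          rw [hr, hr, h2, map_mul, map_mul, map_sum, map_sum]
          congr 1
          exact sum_congr rfl fun j _ => by rw [map_mul, map_mul, u.2 j]
        rw [h1]
        refine hpoly _ (lt_of_le_of_lt (totalDegree_mul _ _) ?_)
        have h3 : (∑ j, g i j * L j).totalDegree ≤ N + 1 :=
          totalDegree_finsetSum_le fun j _ =>
            (totalDegree_mul _ _).trans (add_le_add (hg i j) (hL j))
        have h4 : (monomial t (1 : K)).totalDegree ≤ t.degree := totalDegree_monomial_le t 1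
        omega
  have hall : ∀ p, r p ∈ W := by
    intro p
    rw [p.as_sum, map_sum]
    refine W.sum_mem fun s _ => ?_
    have h1 : monomial s (coeff s p) = coeff s p • monomial s (1 : K) := by
      rw [smul_monomial, smul_eq_mul, mul_one]
    rw [h1, map_smul]
    exact W.smul_mem _ (hmon _ s rfl)
  -- Over a finite field every function on V is the restriction of a polynomial, so the dimension of
  -- W is the cardinality of V.
  have htop : W = ⊤ := by
    rw [eq_top_iff]
    intro F _
    have hsurj : (⊤ : Submodule K ((Fin n → K) → K)) ≤ _ := (map_restrict_dom_evalₗ K (Fin n)).ge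
    obtain ⟨p, _, hp⟩ := hsurj (x := fun u => if h : ∀ j, eval u (G j) = eval u (L j)
      then F ⟨u, h⟩ else 0) trivial
    have : r p = F := by
      funext u
      have := congrFun hp u.1
      rw [evalₗ_apply] at this
      rw [hr, this, dif_pos u.2]
    rw [← this]
    exact hall p
  have hcard : #{u : Fin n → K | ∀ j, eval u (G j) = eval u (L j)} = Fintype.card V :=
    (Fintype.card_subtype _).symm
  rw [hcard, ← Module.finrank_fintype_fun_eq_card K, ← finrank_top, ← htop, hW]
  refine (finrank_range_le_card b).trans ?_
  simp

end Bezout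

/-! ### The weighted count modulo a good prime -/

section PrimeModulus
open Finset
open scoped Classical

variable {n : ℕ} {F : MvPolynomial (Fin n) ℤ}

/-- Euler's identity for the quadratic forms ∂ᵢF, with the symmetry of second derivatives. -/
theorem hessMul_self (hF : F.IsHomogeneous 3) {S : Type*} [CommRing S] (u : Fin n → S) (i : Fin n) :
    hessMul F u u i = 2 * aeval u (pderiv i F) := by
  have h := congrArg (aeval u) ((hF.pderiv (i := i)).sum_X_mul_pderiv)
  rw [map_sum] at h
  simp only [map_mul, aeval_X, nsmul_eq_mul, Nat.reduceSub, Nat.cast_ofNat, map_ofNat] at h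
  rw [hessMul]
  have hcomm : ∀ j, pderiv i (pderiv j F) = pderiv j (pderiv i F) := by
    intro j
    have := congrArg (fun D : Derivation ℤ (MvPolynomial (Fin n) ℤ) (MvPolynomial (Fin n) ℤ) => D F)
      (show ⁅pderiv i, pderiv j⁆ = (0 : Derivation ℤ (MvPolynomial (Fin n) ℤ) _) from
        derivation_ext fun k => by
          rw [Derivation.commutator_apply, pderiv_pderiv_X, pderiv_pderiv_X]; simp)
    rw [Derivation.commutator_apply] at this
    exact sub_eq_zero.1 this
  simp only [hcomm]
  rw [← sum_congr rfl fun j _ => mul_comm (u j) _]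
  exact h

variable (hF : F.IsHomogeneous 3) {D : ℤ} {N : ℕ} {g : Fin n → Fin n → MvPolynomial (Fin n) ℤ}
  (hg : ∀ i j, (g i j).IsHomogeneous N)
  (hid : ∀ i, MvPolynomial.C D * X i ^ (N + 2) = ∑ j, g i j * pderiv j F)

include hF hg hid

/-- Count pairs (u, d) with H(u)d = 0 by z = u - d. For fixed z, Euler's identity makes the
condition 2∇F(u) = H(u)z, where the right side is linear in u, and the Bézout bound gives at most (N
+ 2) ^ n points u. No stratification by the rank of the Hessian is needed. -/
theorem sum_hessKer_le {p : ℕ} [Fact p.Prime] (hp : ¬ (p : ℤ) ∣ 2 * D) :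
    ∑ u : Fin n → ZMod p, hessKer F u ≤ (N + 2) ^ n * p ^ n := by
  set θ := Int.castRingHom (ZMod p) with hθ
  have haev : ∀ (u : Fin n → ZMod p) (q : MvPolynomial (Fin n) ℤ), eval u (map θ q) = aeval u q := by
    intro u q
    rw [eval_map, aeval_def]
    rfl
  have h2D : ((2 * D : ℤ) : ZMod p) ≠ 0 := by
    rw [Ne, ZMod.intCast_zmod_eq_zero_iff_dvd]
    exact hp
  have hz : ∀ z : Fin n → ZMod p,
      #{u : Fin n → ZMod p | ∀ i, hessMul F u (u - z) i = 0} ≤ (N + 2) ^ n := by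
    intro z
    refine le_trans (card_le_card ?_) (card_solutions_le (N := N) (fun j => map θ (2 * pderiv j F))
      (fun j => ∑ l, map θ (pderiv j (pderiv l F)) * MvPolynomial.C (z l))
      (fun i j => MvPolynomial.C ((2 * D : ℤ) : ZMod p)⁻¹ * map θ (g i j)) ?_ ?_ ?_)
    · intro u hu
      simp only [mem_filter, mem_univ, true_and] at hu ⊢
      intro i
      have := hu i
      rw [hessMul_sub, hessMul_self hF, sub_eq_zero] at this
      rw [haev, map_mul, map_ofNat, this, hessMul, map_sum]
      simp only [map_mul, haev, eval_C]
    · intro i j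
      exact ((((hg i j).map θ).C_mul _).totalDegree_le)
    · intro j
      refine totalDegree_finsetSum_le fun l _ => ?_
      have h1 := ((hF.pderiv (i := l)).pderiv (i := j)).map θ
      exact (h1.mul (isHomogeneous_C _ (z l))).totalDegree_le
    · intro i
      have h1 := congrArg (map θ) (hid i)
      simp only [map_mul, map_pow, map_X, map_C, map_sum] at h1
      have h2 : ∀ j, MvPolynomial.C ((2 * D : ℤ) : ZMod p)⁻¹ * map θ (g i j) * map θ (2 * pderiv j F)
          = MvPolynomial.C (((2 * D : ℤ) : ZMod p)⁻¹ * 2) * (map θ (g i j) * map θ (pderiv j F)) := by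
        intro j
        rw [map_mul, map_mul, map_ofNat, map_ofNat]
        ring
      rw [sum_congr rfl fun j _ => h2 j, ← mul_sum, ← h1, ← mul_assoc, ← MvPolynomial.C_mul]
      have h3 : (((2 * D : ℤ) : ZMod p)⁻¹ * 2) * θ D = 1 := by
        have : (2 : ZMod p) * θ D = ((2 * D : ℤ) : ZMod p) := by simp [hθ]
        rw [mul_assoc, this, inv_mul_cancel₀ h2D]
      rw [h3, MvPolynomial.C_1, one_mul]
  have hcount : ∑ u : Fin n → ZMod p, hessKer F u =
      ∑ z : Fin n → ZMod p, #{u : Fin n → ZMod p | ∀ i, hessMul F u (u - z) i = 0} := by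
    simp only [hessKer, card_filter]
    rw [sum_comm' (t' := univ) (s' := fun _ => univ) (by simp)]
    conv_rhs => rw [sum_comm]
    rw [sum_comm]
    refine sum_congr rfl fun u _ => ?_
    rw [← Equiv.sum_comp (Equiv.subLeft u)]
    refine sum_congr rfl fun z _ => ?_
    rw [Equiv.subLeft_apply]
    congr
  rw [hcount]
  refine (sum_le_sum fun z _ => hz z).trans (le_of_eq ?_)
  simp [ZMod.card, mul_comm]

omit hg in
-- Schwartz–Zippel; F is nonzero modulo p, as otherwise `hid` would make D times a power of a
-- variable vanish.
theorem card_zeros_prime_le (hn : 0 < n) {p : ℕ} [Fact p.Prime] (hp : ¬ (p : ℤ) ∣ D) :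
    #{u : Fin n → ZMod p | aeval u F = 0} * p ≤ 3 * p ^ n := by
  set θ := Int.castRingHom (ZMod p) with hθ
  have hne : map θ F ≠ 0 := by
    intro h0
    have h1 := congrArg (map θ) (hid ⟨0, hn⟩)
    simp only [map_mul, map_pow, map_X, map_C, map_sum, ← pderiv_map, h0, map_zero, mul_zero,
      sum_const_zero, mul_eq_zero] at h1
    rcases h1 with h1 | h1
    · rw [MvPolynomial.C_eq_zero] at h1
      exact hp ((ZMod.intCast_zmod_eq_zero_iff_dvd _ _).1 h1)
    · exact X_ne_zero _ (eq_zero_of_pow_eq_zero h1)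
  have hsz := schwartz_zippel_totalDegree hne (univ : Finset (ZMod p))
  have hdeg : (map θ F).totalDegree ≤ 3 := (hF.map θ).totalDegree_le
  have hp0 : (0 : ℚ≥0) < p := by exact_mod_cast (Fact.out : p.Prime).pos
  rw [Finset.card_univ, ZMod.card, div_le_div_iff₀ (by positivity) hp0] at hsz
  have h2 : #{f ∈ Fintype.piFinset fun _ : Fin n => (univ : Finset (ZMod p)) | eval f (map θ F) = 0} =
      #{u : Fin n → ZMod p | aeval u F = 0} := by
    congr 1
    ext u
    simp only [mem_filter, Fintype.mem_piFinset, mem_univ, implies_true, true_and]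
    rw [eval_map, aeval_def]
    rfl
  rw [h2] at hsz
  have h3 : #{u : Fin n → ZMod p | aeval u F = 0} * p ≤ (map θ F).totalDegree * p ^ n := by
    exact_mod_cast hsz
  exact h3.trans (Nat.mul_le_mul_right _ hdeg)

/-- Cauchy–Schwarz between the O(p^(n-1)) zeros and the total kernel size O(p^n) over all u. -/
theorem sum_sqrt_hessKer_le (hn : 0 < n) {p : ℕ} [Fact p.Prime] (hp : ¬ (p : ℤ) ∣ 2 * D) :
    ∑ u : Fin n → ZMod p, (if aeval u F = 0 then √(hessKer F u : ℝ) else 0) ≤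
      (3 * (N + 2) ^ n : ℕ) * (p : ℝ) ^ (n - 1) * √p := by
  have hp0 : 0 < (p : ℝ) := by exact_mod_cast (Fact.out : p.Prime).pos
  have hZ := card_zeros_prime_le hF hid hn (p := p) fun h => hp (h.mul_left 2)
  have hS := sum_hessKer_le hF hg hid hp
  rw [← sum_filter]
  set Z := ({u : Fin n → ZMod p | aeval u F = 0} : Finset (Fin n → ZMod p)) with hZdef
  have hcs := sum_mul_sq_le_sq_mul_sq Z (fun _ => (1 : ℝ)) (fun u => √(hessKer F u : ℝ))
  simp only [one_mul, one_pow, sum_const, nsmul_eq_mul, mul_one, Real.sq_sqrt (Nat.cast_nonneg _)]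
    at hcs
  have hZ' : (#Z : ℝ) ≤ 3 * p ^ (n - 1) := by
    have h1 : (#Z : ℝ) * p ≤ 3 * p ^ (n - 1) * p := by
      rw [mul_assoc, ← pow_succ, Nat.sub_add_cancel hn]
      exact_mod_cast hZ
    exact le_of_mul_le_mul_right h1 hp0
  have hS' : ∑ u ∈ Z, (hessKer F u : ℝ) ≤ (N + 2) ^ n * (p ^ (n - 1) * p) := by
    rw [← pow_succ, Nat.sub_add_cancel hn]
    refine le_trans (sum_le_univ_sum_of_nonneg fun u => Nat.cast_nonneg _) ?_
    exact_mod_cast hS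
  have h1 : (1 : ℝ) ≤ 3 * (N + 2) ^ n := by
    have : (1 : ℝ) ≤ (N + 2) ^ n := one_le_pow₀ (by linarith [(Nat.cast_nonneg N : (0 : ℝ) ≤ N)])
    linarith
  refine abs_le_of_sq_le_sq' (hcs.trans ?_) (by positivity) |>.2
  calc (#Z : ℝ) * ∑ u ∈ Z, (hessKer F u : ℝ)
      ≤ (3 * p ^ (n - 1)) * ((N + 2) ^ n * (p ^ (n - 1) * p)) := by gcongr
    _ = (3 * (N + 2) ^ n) * ((p : ℝ) ^ (n - 1)) ^ 2 * p := by ring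
    _ ≤ (3 * (N + 2) ^ n) ^ 2 * ((p : ℝ) ^ (n - 1)) ^ 2 * p := by
        gcongr
        nlinarith
    _ = _ := by
        rw [mul_pow, mul_pow, Real.sq_sqrt hp0.le]
        push_cast
        ring

end PrimeModulus

/-! ### Hensel lifting of primitive zeros -/

section Lifting
open Finset
open scoped Classical

variable {n : ℕ}

theorem pow_sub_dvd_of_pow_dvd_mul {p : ℕ} (hp : p.Prime) {a b e j : ℕ} (h : p ^ j ∣ a * b)
    (hb : ¬ p ^ (e + 1) ∣ b) : p ^ (j - e) ∣ a := by
  have hb0 : b ≠ 0 := fun h0 => hb (h0 ▸ dvd_zero _)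
  obtain ⟨s, b', hb', rfl⟩ := Nat.exists_eq_pow_mul_and_not_dvd hb0 p hp.ne_one
  have hse : s ≤ e := by
    by_contra hlt
    exact hb ((pow_dvd_pow p (not_le.1 hlt)).mul_right b')
  have hcop : Nat.Coprime (p ^ j) b' := ((Nat.Prime.coprime_iff_not_dvd hp).2 hb').pow_left j
  rw [← mul_assoc] at h
  have h1 : p ^ j ∣ a * p ^ s := hcop.dvd_of_dvd_mul_right h
  rcases le_total s j with hsj | hjs
  · rw [← Nat.sub_add_cancel hsj, pow_add] at h1
    have h2 := Nat.dvd_of_mul_dvd_mul_right (pow_pos hp.pos s) h1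
    exact (pow_dvd_pow p (Nat.sub_le_sub_left hse j)).trans h2
  · rw [Nat.sub_eq_zero_of_le (hjs.trans hse), pow_zero]
    exact one_dvd _

theorem castHom_eq_zero_iff_dvd_val {a b : ℕ} [NeZero a] (h : b ∣ a) (z : ZMod a) :
    ZMod.castHom h (ZMod b) z = 0 ↔ b ∣ z.val := by
  conv_lhs => rw [← ZMod.natCast_zmod_val z, map_natCast]
  exact ZMod.natCast_eq_zero_iff _ _

theorem castHom_eq_zero_of_mul_eq_zero {p e j M q r : ℕ} [NeZero M] (hp : p.Prime)
    (hM : M = p ^ j) (hq : q = p ^ (e + 1)) (hr : r = p ^ (j - e)) (hqM : q ∣ M) (hrM : r ∣ M)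
    {δ w : ZMod M} (h : δ * w = 0) (hw : ZMod.castHom hqM (ZMod q) w ≠ 0) :
    ZMod.castHom hrM (ZMod r) δ = 0 := by
  rw [castHom_eq_zero_iff_dvd_val, hr]
  rw [Ne, castHom_eq_zero_iff_dvd_val, hq] at hw
  refine pow_sub_dvd_of_pow_dvd_mul hp ?_ hw
  rw [← hM, ← ZMod.natCast_eq_zero_iff]
  push_cast
  rw [ZMod.natCast_zmod_val, ZMod.natCast_zmod_val, h]

theorem card_castHom_fiber {a b c : ℕ} [NeZero a] [NeZero b] (h : b ∣ a) (hc : a = b * c)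
    (z : ZMod b) : #{x : ZMod a | ZMod.castHom h (ZMod b) x = z} = c := by
  have := card_filter_comp_surjective (ZMod.castHom h (ZMod b)).toAddMonoidHom
    (ZMod.castHom_surjective h) (fun x => x = z)
  have h1 : #{x : ZMod b | x = z} = 1 := card_eq_one.2 ⟨z, by ext; simp⟩
  rw [h1, ZMod.card, ZMod.card, mul_one] at this
  exact Nat.eq_of_mul_eq_mul_left (NeZero.pos b) (this.trans hc)

theorem card_reduceVec_fiber {a b c : ℕ} [NeZero a] [NeZero b] (h : b ∣ a) (hc : a = b * c)
    (z : Fin n → ZMod b) : #{x : Fin n → ZMod a | reduceVec h x = z} = c ^ n := by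
  have := card_filter_comp_surjective (reduceVec (ι := Fin n) h) (reduceVec_surjective h)
    (fun x => x = z)
  have h1 : #{x : Fin n → ZMod b | x = z} = 1 := card_eq_one.2 ⟨z, by ext; simp⟩
  rw [h1] at this
  simp only [Fintype.card_pi, ZMod.card, prod_const, Finset.card_univ, Fintype.card_fin, mul_one] at this
  refine Nat.eq_of_mul_eq_mul_left (pow_pos (NeZero.pos b) n) (this.trans ?_)
  rw [hc, mul_pow]

/-- A quantitative Hensel lemma. -/
theorem card_lifts_le {p e j M q : ℕ} [NeZero M] [NeZero q] (hp : p.Prime) (hej : e + 1 ≤ j)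
    (hM : M = p ^ j) (hq : q = p ^ (e + 1)) (hqM : q ∣ M) (F : MvPolynomial (Fin n) ℤ)
    (u₀ : Fin n → ZMod q) {i : Fin n} (hi : aeval u₀ (pderiv i F) ≠ 0) :
    #{u : Fin n → ZMod M | aeval u F = 0 ∧ reduceVec hqM u = u₀} ≤
      p ^ e * p ^ ((n - 1) * (j - (e + 1))) := by
  set d := j - (e + 1) with hd
  have hMq : M = q * p ^ d := by rw [hM, hq, ← pow_add]; congr 1; omega
  set r := p ^ (j - e) with hr
  have hrM : r ∣ M := by rw [hM]; exact pow_dvd_pow p (Nat.sub_le j e)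
  have hMr : M = r * p ^ e := by rw [hM, hr, ← pow_add]; congr 1; omega
  have : NeZero r := ⟨fun h => NeZero.ne M (by rw [hMr, h, zero_mul])⟩
  set S := ({u | aeval u F = 0 ∧ reduceVec hqM u = u₀} : Finset (Fin n → ZMod M)) with hS
  set T := ({τ | ZMod.castHom hqM (ZMod q) τ = 0} : Finset (ZMod M)) with hT
  set A := ({w | reduceVec hqM w = u₀} : Finset (Fin n → ZMod M)) with hA
  have hTcard : #T = p ^ d := card_castHom_fiber hqM hMq 0
  have hAcard : #A = (p ^ d) ^ n := card_reduceVec_fiber hqM hMq u₀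
  have hsingle : ∀ τ ∈ T, reduceVec hqM (Pi.single i τ : Fin n → ZMod M) = 0 := by
    intro τ hτ
    simp only [hT, mem_filter, mem_univ, true_and] at hτ
    funext l
    rw [reduceVec_apply, Pi.single_apply]
    split_ifs
    · exact hτ
    · exact map_zero _
  -- Move each zero u in coordinate i by a multiple τ of q. If two pairs have the same image, their
  -- zeros differ by δ = τ - τ₁ in coordinate i, and Taylor gives δ(∂ᵢF(u) + δs) = 0 with bracket
  -- nonzero modulo p^(e+1). So p^(j-e) divides δ, leaving at most p^e pairs.
  have hmul : #(S ×ˢ T) ≤ p ^ e * #A := by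
    refine card_le_mul_card_image_of_maps_to (f := fun x => x.1 + Pi.single i x.2) ?_ _ ?_
    · rintro ⟨u, τ⟩ hx
      rw [mem_product] at hx
      have h1 := hsingle τ hx.2
      simp only [hS, hA, mem_filter, mem_univ, true_and] at hx ⊢
      rw [map_add, h1, add_zero]
      exact hx.1.2
    · intro b _
      rcases ({x ∈ S ×ˢ T | x.1 + Pi.single i x.2 = b} : Finset _).eq_empty_or_nonempty with h | ⟨⟨u₁, τ₁⟩, h₁⟩
      · rw [h]; simp
      · rw [← card_castHom_fiber hrM hMr (ZMod.castHom hrM (ZMod r) τ₁)]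
        rw [mem_filter, mem_product] at h₁
        refine card_le_card_of_injOn Prod.snd ?_ ?_
        · rintro ⟨u, τ⟩ hx
          simp only [coe_filter, mem_product, Set.mem_ofPred_eq] at hx
          simp only [coe_filter, mem_univ, true_and, Set.mem_ofPred_eq]
          rw [← sub_eq_zero, ← map_sub]
          obtain ⟨s, hs⟩ := aeval_add_mul F u (Pi.single i 1) (τ - τ₁)
          have hu₁ : (fun l => u l + (τ - τ₁) * (Pi.single i 1 : Fin n → ZMod M) l) = u₁ := by
            funext l
            have h2 := congrFun (hx.2.trans h₁.2.symm) l
            simp only [Pi.add_apply] at h2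
            by_cases hl : l = i
            · subst hl
              simp only [Pi.single_eq_same] at h2 ⊢
              linear_combination h2
            · simp only [Pi.single_eq_of_ne hl] at h2 ⊢
              linear_combination h2
          have hsum : ∑ l, (Pi.single i 1 : Fin n → ZMod M) l * aeval u (pderiv l F) =
              aeval u (pderiv i F) := by
            rw [Finset.sum_eq_single i] <;> simp +contextual
          simp only [hS, hT, mem_filter, mem_univ, true_and] at hx h₁
          rw [hu₁, hsum, hx.1.1.1, h₁.1.1.1] at hs
          have hδ : ZMod.castHom hqM (ZMod q) (τ - τ₁) = 0 := by
            rw [map_sub, hx.1.2, h₁.1.2, sub_zero]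
          refine castHom_eq_zero_of_mul_eq_zero hp hM hq hr hqM hrM
            (w := aeval u (pderiv i F) + (τ - τ₁) * s) (by linear_combination -hs) ?_
          rw [map_add, map_mul, hδ, zero_mul, add_zero, ← aeval_reduceVec, hx.1.1.2]
          exact hi
        · rintro ⟨u, τ⟩ hx ⟨u', τ'⟩ hx' h
          simp only [coe_filter, mem_product, Set.mem_ofPred_eq] at hx hx' h
          subst h
          have := add_right_cancel (hx.2.trans hx'.2.symm)
          rw [this]
  rw [card_product, hTcard, hAcard] at hmul
  have hn : 0 < n := i.pos
  have hpd : 0 < p ^ d := pow_pos hp.pos d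
  refine Nat.le_of_mul_le_mul_right (hmul.trans (le_of_eq ?_)) hpd
  obtain ⟨m, rfl⟩ : ∃ m, n = m + 1 := ⟨n - 1, by omega⟩
  rw [Nat.add_sub_cancel, ← pow_mul]
  ring

variable {F : MvPolynomial (Fin n) ℤ}
  {D : ℤ} {N : ℕ} {g : Fin n → Fin n → MvPolynomial (Fin n) ℤ}
  (hid : ∀ i, MvPolynomial.C D * X i ^ (N + 2) = ∑ j, g i j * pderiv j F)

include hid in
-- If the whole gradient vanished at u, `hid` at a unit coordinate would give D = 0 modulo q.
theorem exists_pderiv_ne_zero {q : ℕ} (hq : ¬ (q : ℤ) ∣ D) (u : Fin n → ZMod q)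
    (hu : ∃ i, IsUnit (u i)) : ∃ i, aeval u (pderiv i F) ≠ 0 := by
  by_contra! h
  obtain ⟨i, hi⟩ := hu
  have := congrArg (aeval u) (hid i)
  simp only [map_mul, map_pow, aeval_X, map_sum, h, mul_zero, sum_const_zero, aeval_C] at this
  have h1 := ((hi.pow (N + 2)).mul_left_eq_zero).1 this
  exact hq ((ZMod.intCast_zmod_eq_zero_iff_dvd _ _).1 h1)

include hid in
-- The weight depends only on u modulo q, so group zeros by that reduction and bound each group by
-- `card_lifts_le`.
theorem sum_primitive_zeros_le {p e j M q : ℕ} [NeZero M] [NeZero q] (hp : p.Prime)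
    (hej : e + 1 ≤ j) (hM : M = p ^ j) (hq : q = p ^ (e + 1)) (hqM : q ∣ M)
    (hqD : ¬ (q : ℤ) ∣ D) (ω : (Fin n → ZMod q) → ℝ) (hω : ∀ u, 0 ≤ ω u) :
    ∑ u : Fin n → ZMod M, (if aeval u F = 0 ∧ ∃ i, IsUnit (u i) then ω (reduceVec hqM u) else 0) ≤
      (∑ u : Fin n → ZMod q, if aeval u F = 0 then ω u else 0) *
        ((p : ℝ) ^ e * (p : ℝ) ^ ((n - 1) * (j - (e + 1)))) := by
  rw [← Finset.sum_fiberwise univ (reduceVec hqM), sum_mul]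
  refine sum_le_sum fun u₀ _ => ?_
  rw [sum_congr rfl (g := fun u => if aeval u F = 0 ∧ ∃ i, IsUnit (u i) then ω u₀ else 0)
    (fun u hu => by simp only [mem_filter, mem_univ, true_and] at hu; rw [hu])]
  by_cases h : aeval u₀ F = 0 ∧ ∃ i, IsUnit (u₀ i)
  · rw [if_pos h.1]
    obtain ⟨i, hi⟩ := exists_pderiv_ne_zero hid hqD u₀ h.2
    rw [← sum_filter, sum_const, nsmul_eq_mul, mul_comm]
    refine mul_le_mul_of_nonneg_left ?_ (hω u₀)
    have h1 := card_lifts_le hp hej hM hq hqM F u₀ hi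
    refine le_trans (Nat.cast_le.2 (card_le_card ?_)) (by exact_mod_cast h1)
    intro u hu
    simp only [mem_filter, mem_univ, true_and] at hu ⊢
    exact ⟨hu.2.1, hu.1⟩
  · rw [sum_eq_zero]
    · split_ifs
      · exact mul_nonneg (hω u₀) (by positivity)
      · rw [zero_mul]
    · intro u hu
      simp only [mem_filter, mem_univ, true_and] at hu
      refine if_neg fun h' => h ⟨?_, ?_⟩
      · rw [← hu, aeval_reduceVec, h'.1, map_zero]
      · obtain ⟨i, hi⟩ := h'.2
        exact ⟨i, by rw [← hu]; exact hi.map (ZMod.castHom hqM (ZMod q))⟩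

end Lifting

/-! ### Imprimitive zeros and zero counts modulo prime powers -/

section PrimePowerModulus
open Finset
open scoped Classical

variable {n : ℕ} {F : MvPolynomial (Fin n) ℤ}

theorem aeval_mul_of_isHomogeneous {σ S : Type*} [CommRing S] {φ : MvPolynomial σ ℤ} {d : ℕ}
    (hφ : φ.IsHomogeneous d) (t : S) (w : σ → S) :
    aeval (fun i => t * w i) φ = t ^ d * aeval w φ := by
  rw [φ.as_sum, map_sum, map_sum, mul_sum]
  refine sum_congr rfl fun s hs => ?_
  rw [aeval_monomial, aeval_monomial, Finsupp.prod, Finsupp.prod]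
  simp only [mul_pow]
  rw [prod_mul_distrib, prod_pow_eq_pow_sum]
  have : ∑ i ∈ s.support, s i = d := (hφ.degree_eq_sum_deg_support hs).symm
  rw [this]
  ring

theorem exists_eq_mul_of_castHom_eq_zero {p M : ℕ} [NeZero M] (hpM : p ∣ M) {z : ZMod M}
    (hz : ZMod.castHom hpM (ZMod p) z = 0) : ∃ w : ZMod M, z = p * w := by
  rw [castHom_eq_zero_iff_dvd_val] at hz
  obtain ⟨m, hm⟩ := hz
  exact ⟨m, by rw [← Nat.cast_mul, ← hm, ZMod.natCast_zmod_val]⟩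

/-- Zeros of a cubic form modulo `p ^ 3 * M'` all of whose coordinates are divisible by `p`. -/
theorem card_divisible_zeros_le (hF : F.IsHomogeneous 3) {p M M' : ℕ} [NeZero M] [NeZero M']
    (hp : 0 < p) (hM : M = p ^ 3 * M') (hpM : p ∣ M) :
    #{u : Fin n → ZMod M | aeval u F = 0 ∧ ∀ i, ZMod.castHom hpM (ZMod p) (u i) = 0} ≤
      p ^ (2 * n) * #{u : Fin n → ZMod M' | aeval u F = 0} := by
  have hM'M : M' ∣ M := by rw [hM]; exact dvd_mul_left _ _
  have : NeZero p := ⟨hp.ne'⟩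
  have : NeZero (p ^ 3) := ⟨pow_ne_zero 3 hp.ne'⟩
  set c := p ^ 2 * M' with hc
  have hcM : c ∣ M := ⟨p, by rw [hM, hc]; ring⟩
  have hMc : M = c * p := by rw [hM, hc]; ring
  have : NeZero c := ⟨mul_ne_zero (pow_ne_zero 2 hp.ne') (NeZero.ne M')⟩
  set S := ({u | aeval u F = 0 ∧ ∀ i, ZMod.castHom hpM (ZMod p) (u i) = 0} :
    Finset (Fin n → ZMod M)) with hS
  set K := ({κ | reduceVec hcM κ = 0} : Finset (Fin n → ZMod M)) with hK
  set W := ({w | aeval (reduceVec hM'M w) F = 0} : Finset (Fin n → ZMod M)) with hW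
  have hKcard : #K = p ^ n := card_reduceVec_fiber hcM hMc 0
  have hWcard : #W = p ^ (3 * n) * #{u : Fin n → ZMod M' | aeval u F = 0} := by
    have := card_filter_comp_surjective (reduceVec (ι := Fin n) hM'M) (reduceVec_surjective hM'M)
      (fun u => aeval u F = 0)
    simp only [Fintype.card_pi, ZMod.card, prod_const, Finset.card_univ, Fintype.card_fin] at this
    refine Nat.eq_of_mul_eq_mul_left (pow_pos (NeZero.pos M') n) (this.trans ?_)
    conv_lhs => enter [1]; rw [hM]
    rw [mul_pow, ← pow_mul]
    ring
  have hdiv : ∀ u ∈ S, ∃ w : Fin n → ZMod M, ∀ i, u i = p * w i := by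
    intro u hu
    simp only [hS, mem_filter, mem_univ, true_and] at hu
    choose w hw using fun i => exists_eq_mul_of_castHom_eq_zero hpM (hu.2 i)
    exact ⟨w, hw⟩
  choose! w hw using hdiv
  have hmulK : ∀ κ ∈ K, ∀ i, (p : ZMod M) * κ i = 0 := by
    intro κ hκ i
    simp only [hK, mem_filter, mem_univ, true_and] at hκ
    rw [natCast_mul_eq_zero_iff_castHom (by rw [hMc, mul_comm]) hcM]
    exact congrFun hκ i
  -- Write u = pw with w determined up to K, the kernel of multiplication by p. Then F(u) = p³F(w),
  -- so F(w) = 0 modulo M'. Dividing the p^(3n) lifts from M' to M by #K = p^n gives the factor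
  -- p^(2n).
  have hcard : #(S ×ˢ K) ≤ #W := by
    refine card_le_card_of_injOn (fun x => w x.1 + x.2) ?_ ?_
    · rintro ⟨u, κ⟩ hx
      simp only [coe_product, Set.mem_prod, mem_coe] at hx
      have h1 : (fun i => (p : ZMod M) * (w u + κ) i) = u := by
        funext i
        rw [Pi.add_apply, mul_add, hmulK κ hx.2, add_zero, ← hw u hx.1]
      have h2 := aeval_mul_of_isHomogeneous hF (p : ZMod M) (w u + κ)
      rw [h1] at h2
      have h3 : aeval u F = 0 := by
        have := hx.1
        simp only [hS, mem_filter, mem_univ, true_and] at this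
        exact this.1
      simp only [hW, coe_filter, mem_univ, true_and, Set.mem_ofPred_eq]
      rw [aeval_reduceVec, ← natCast_mul_eq_zero_iff_castHom hM.symm hM'M]
      push_cast
      rw [← h2, h3]
    · rintro ⟨u, κ⟩ hx ⟨u', κ'⟩ hx' h
      simp only [coe_product, Set.mem_prod, mem_coe] at hx hx' h
      have huu : u = u' := by
        funext i
        have h1 := congrFun h i
        simp only [Pi.add_apply] at h1
        rw [hw u hx.1, hw u' hx'.1]
        linear_combination (p : ZMod M) * h1 - hmulK κ hx.2 i + hmulK κ' hx'.2 i
      subst huu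
      rw [add_left_cancel h]
  rw [card_product, hKcard, hWcard] at hcard
  refine Nat.le_of_mul_le_mul_right (hcard.trans (le_of_eq ?_)) (pow_pos hp n)
  rw [show 3 * n = 2 * n + n by ring, pow_add]
  ring

theorem isUnit_or_castHom_eq_zero {p j M : ℕ} [NeZero M] (hp : p.Prime) (hM : M = p ^ j)
    (hpM : p ∣ M) (z : ZMod M) : IsUnit z ∨ ZMod.castHom hpM (ZMod p) z = 0 := by
  rw [castHom_eq_zero_iff_dvd_val]
  by_cases h : p ∣ z.val
  · exact Or.inr h
  · left
    have h1 : Nat.Coprime z.val (p ^ j) :=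
      ((Nat.Prime.coprime_iff_not_dvd hp).2 h).symm.pow_right j
    rw [← ZMod.natCast_zmod_val z, ZMod.isUnit_iff_coprime]
    exact h1.coprime_dvd_right (dvd_of_eq hM)

/-- The number of zeros of `F` modulo `M`. -/
noncomputable def zeroCountMod (F : MvPolynomial (Fin n) ℤ) (M : ℕ) [NeZero M] : ℕ :=
  #{u : Fin n → ZMod M | aeval u F = 0}

/-- The number of zeros of `F` modulo `M` that have a unit coordinate. -/
noncomputable def primitiveZeroCountMod (F : MvPolynomial (Fin n) ℤ) (M : ℕ) [NeZero M] : ℕ :=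
  #{u : Fin n → ZMod M | aeval u F = 0 ∧ ∃ i, IsUnit (u i)}

/-- The number of zeros of `F` modulo `M` without a unit coordinate. -/
noncomputable def imprimitiveZeroCountMod (F : MvPolynomial (Fin n) ℤ) (M : ℕ) [NeZero M] : ℕ :=
  #{u : Fin n → ZMod M | aeval u F = 0 ∧ ¬ ∃ i, IsUnit (u i)}

theorem zeroCountMod_eq (F : MvPolynomial (Fin n) ℤ) (M : ℕ) [NeZero M] :
    zeroCountMod F M = primitiveZeroCountMod F M + imprimitiveZeroCountMod F M := by
  rw [zeroCountMod, primitiveZeroCountMod, imprimitiveZeroCountMod, ← filter_filter, ← filter_filter,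
    card_filter_add_card_filter_not]

theorem imprimitive_iff {p j M : ℕ} [NeZero M] (hp : p.Prime) (hM : M = p ^ j)
    (hpM : p ∣ M) (u : Fin n → ZMod M) :
    (¬ ∃ i, IsUnit (u i)) ↔ ∀ i, ZMod.castHom hpM (ZMod p) (u i) = 0 := by
  have : Fact p.Prime := ⟨hp⟩
  rw [not_exists]
  refine forall_congr' fun i => ⟨fun h => (isUnit_or_castHom_eq_zero hp hM hpM _).resolve_left h,
    fun h hu => ?_⟩
  exact (hu.map (ZMod.castHom hpM (ZMod p))).ne_zero h

/-- Imprimitive zeros save a factor p^(n-3): for j ≥ 3 homogeneity reduces to modulus p^(j-3), and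
2n + (j-3)(n-1) + (n-3) = j(n-1); for j < 3 it suffices to count all vectors divisible by p. -/
theorem imprimitiveZeroCountMod_mul_le (hF : F.IsHomogeneous 3) (hn : 4 ≤ n) {p : ℕ}
    [hp : Fact p.Prime] {c : ℝ} (hc : 1 ≤ c) {j : ℕ} (hj : 1 ≤ j)
    (hN : ∀ i < j, (zeroCountMod F (p ^ i) : ℝ) ≤ 2 * c * (p : ℝ) ^ (i * (n - 1))) :
    (imprimitiveZeroCountMod F (p ^ j) : ℝ) * (p : ℝ) ^ (n - 3) ≤
      2 * c * (p : ℝ) ^ (j * (n - 1)) := by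
  have hp0 := hp.out.pos
  have hpR : (1 : ℝ) ≤ p := by exact_mod_cast hp0
  have hpj : p ∣ p ^ j := dvd_pow_self p (by omega)
  have himp : imprimitiveZeroCountMod F (p ^ j) = #{u : Fin n → ZMod (p ^ j) | aeval u F = 0 ∧
      ∀ i, ZMod.castHom hpj (ZMod p) (u i) = 0} := by
    rw [imprimitiveZeroCountMod]
    congr 1
    ext u
    simp only [mem_filter, mem_univ, true_and, imprimitive_iff hp.out rfl hpj u]
  rcases lt_or_ge j 3 with hj3 | hj3
  · have h1 : imprimitiveZeroCountMod F (p ^ j) ≤ (p ^ (j - 1)) ^ n := by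
      rw [himp, ← card_reduceVec_fiber (n := n) hpj
        (show p ^ j = p * p ^ (j - 1) by rw [← pow_succ', Nat.sub_add_cancel hj]) 0]
      refine card_le_card fun u hu => ?_
      simp only [mem_filter, mem_univ, true_and] at hu ⊢
      exact funext hu.2
    have h2 : (imprimitiveZeroCountMod F (p ^ j) : ℝ) ≤ ((p : ℝ) ^ (j - 1)) ^ n := by
      exact_mod_cast h1
    calc (imprimitiveZeroCountMod F (p ^ j) : ℝ) * (p : ℝ) ^ (n - 3)
        ≤ ((p : ℝ) ^ (j - 1)) ^ n * (p : ℝ) ^ (n - 3) := by gcongr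
      _ = (p : ℝ) ^ ((j - 1) * n + (n - 3)) := by rw [← pow_mul, ← pow_add]
      _ ≤ (p : ℝ) ^ (j * (n - 1)) := pow_le_pow_right₀ hpR (by interval_cases j <;> omega)
      _ ≤ 2 * c * (p : ℝ) ^ (j * (n - 1)) := le_mul_of_one_le_left (by positivity) (by linarith)
  · obtain ⟨i, rfl⟩ : ∃ i, j = i + 3 := ⟨j - 3, by omega⟩
    have h1 := card_divisible_zeros_le hF hp0 (show p ^ (i + 3) = p ^ 3 * p ^ i by ring) hpj
    rw [← himp] at h1
    have h2 : (imprimitiveZeroCountMod F (p ^ (i + 3)) : ℝ) ≤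
        (p : ℝ) ^ (2 * n) * zeroCountMod F (p ^ i) := by exact_mod_cast h1
    calc (imprimitiveZeroCountMod F (p ^ (i + 3)) : ℝ) * (p : ℝ) ^ (n - 3)
        ≤ ((p : ℝ) ^ (2 * n) * (2 * c * (p : ℝ) ^ (i * (n - 1)))) * (p : ℝ) ^ (n - 3) := by
          gcongr
          exact h2.trans (by gcongr; exact hN i (by omega))
      _ = 2 * c * (p : ℝ) ^ (2 * n + i * (n - 1) + (n - 3)) := by rw [pow_add, pow_add]; ring
      _ = _ := by
        congr 2
        rw [add_mul]
        omega

/-- Induction on j: since p^(n-3) ≥ 2, imprimitive zeros use up at most half of the bound 2c, and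
primitive ones the other half. -/
theorem zeroCountMod_le (hF : F.IsHomogeneous 3) (hn : 4 ≤ n) {p : ℕ} [hp : Fact p.Prime]
    {c : ℝ} (hc : 1 ≤ c)
    (hP : ∀ j, 1 ≤ j → (primitiveZeroCountMod F (p ^ j) : ℝ) ≤ c * (p : ℝ) ^ (j * (n - 1))) (j : ℕ) :
    (zeroCountMod F (p ^ j) : ℝ) ≤ 2 * c * (p : ℝ) ^ (j * (n - 1)) := by
  induction j using Nat.strong_induction_on with
  | _ j ih =>
    have hp2 : (2 : ℝ) ≤ p := by exact_mod_cast hp.out.two_le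
    rcases Nat.eq_zero_or_pos j with rfl | hj
    · have : zeroCountMod F (p ^ 0) ≤ 1 := by
        rw [zeroCountMod]
        refine (card_le_univ _).trans (le_of_eq ?_)
        simp
      have h1 : (zeroCountMod F (p ^ 0) : ℝ) ≤ 1 := by exact_mod_cast this
      simp only [zero_mul, pow_zero, mul_one] at h1 ⊢
      linarith
    · have h1 := imprimitiveZeroCountMod_mul_le hF hn hc hj ih
      have h2 : (2 : ℝ) ≤ (p : ℝ) ^ (n - 3) :=
        hp2.trans (le_self_pow₀ (by linarith) (by omega))
      have h3 : (imprimitiveZeroCountMod F (p ^ j) : ℝ) * 2 ≤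
          imprimitiveZeroCountMod F (p ^ j) * (p : ℝ) ^ (n - 3) := by gcongr
      rw [zeroCountMod_eq]
      push_cast
      linarith [hP j hj]

end PrimePowerModulus

/-! ### The weighted count modulo prime powers -/

section LocalBound
open Finset
open scoped Classical

variable {n : ℕ} {F : MvPolynomial (Fin n) ℤ}

theorem hessKer_le (F : MvPolynomial (Fin n) ℤ) {R : ℕ} [NeZero R] (a : Fin n → ZMod R) :
    hessKer F a ≤ R ^ n := by
  refine (card_le_univ _).trans (le_of_eq ?_)
  simp [ZMod.card]

theorem hessWeightedCount_le_zeroCountMod_mul (F : MvPolynomial (Fin n) ℤ) {M R : ℕ} [NeZero M]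
    [NeZero R] (hRM : R ∣ M) : hessWeightedCount F hRM ≤ zeroCountMod F M * √((R : ℝ) ^ n) := by
  rw [hessWeightedCount, ← sum_filter, zeroCountMod, ← nsmul_eq_mul]
  refine sum_le_card_nsmul _ _ _ fun u _ => Real.sqrt_le_sqrt ?_
  exact_mod_cast hessKer_le F _

theorem hessWeightedCount_le_primitive_add (F : MvPolynomial (Fin n) ℤ) {M R : ℕ} [NeZero M]
    [NeZero R] (hRM : R ∣ M) : hessWeightedCount F hRM ≤
      (∑ u : Fin n → ZMod M, if aeval u F = 0 ∧ ∃ i, IsUnit (u i) then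
        √(hessKer F (reduceVec hRM u) : ℝ) else 0) +
      imprimitiveZeroCountMod F M * √((R : ℝ) ^ n) := by
  rw [hessWeightedCount, imprimitiveZeroCountMod, ← sum_filter, ← sum_filter, ← filter_filter,
    ← filter_filter, ← sum_filter_add_sum_filter_not _ (fun u : Fin n → ZMod M => ∃ i, IsUnit (u i)),
    ← nsmul_eq_mul]
  refine add_le_add_right (sum_le_card_nsmul _ _ _ fun u _ => Real.sqrt_le_sqrt ?_) _
  exact_mod_cast hessKer_le F _

theorem sqrt_pow_le {R a : ℝ} (hR : 0 ≤ R) (ha : 0 ≤ a) {n : ℕ} (hn : 0 < n)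
    (h : R ^ (n - 1) ≤ a ^ 2) : √(R ^ n) ≤ a * √R := by
  obtain ⟨m, rfl⟩ : ∃ m, n = m + 1 := ⟨n - 1, by omega⟩
  rw [pow_succ, Real.sqrt_mul (by positivity)]
  exact mul_le_mul_of_nonneg_right (Real.sqrt_le_iff.2 ⟨ha, h⟩) (Real.sqrt_nonneg _)

variable (hF : F.IsHomogeneous 3) {D : ℤ} {N : ℕ} {g : Fin n → Fin n → MvPolynomial (Fin n) ℤ}
  (hg : ∀ i j, (g i j).IsHomogeneous N)
  (hid : ∀ i, MvPolynomial.C D * X i ^ (N + 2) = ∑ j, g i j * pderiv j F)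

include hid in
theorem primitiveZeroCountMod_le_zeroCountMod_mul {p e j M q : ℕ} [NeZero M] [NeZero q]
    (hp : p.Prime) (hej : e + 1 ≤ j) (hM : M = p ^ j) (hq : q = p ^ (e + 1))
    (hqD : ¬ (q : ℤ) ∣ D) : (primitiveZeroCountMod F M : ℝ) ≤
      zeroCountMod F q * ((p : ℝ) ^ e * (p : ℝ) ^ ((n - 1) * (j - (e + 1)))) := by
  have hqM : q ∣ M := by rw [hM, hq]; exact pow_dvd_pow p hej
  have := sum_primitive_zeros_le hid hp hej hM hq hqM hqD (fun _ => 1) fun _ => zero_le_one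
  rwa [← sum_filter, ← sum_filter, sum_const, sum_const, nsmul_eq_mul, nsmul_eq_mul, mul_one,
    mul_one] at this

include hF hid in
theorem primitiveZeroCountMod_le_of_not_dvd (hn : 0 < n) {p j : ℕ} [hp : Fact p.Prime] (hj : 1 ≤ j)
    (hpD : ¬ (p : ℤ) ∣ D) :
    (primitiveZeroCountMod F (p ^ j) : ℝ) ≤ 3 * (p : ℝ) ^ (j * (n - 1)) := by
  have h1 := primitiveZeroCountMod_le_zeroCountMod_mul hid (e := 0) (M := p ^ j) hp.out hj rfl
    (pow_one p).symm hpD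
  have hp0 : (0 : ℝ) < p := by exact_mod_cast hp.out.pos
  have h2 : (zeroCountMod F p : ℝ) ≤ 3 * p ^ (n - 1) := by
    have h3 : (zeroCountMod F p : ℝ) * p ≤ 3 * p ^ (n - 1) * p := by
      rw [mul_assoc, ← pow_succ, Nat.sub_add_cancel hn]
      exact_mod_cast card_zeros_prime_le hF hid hn hpD
    exact le_of_mul_le_mul_right h3 hp0
  calc _ ≤ _ := h1
    _ ≤ (3 * (p : ℝ) ^ (n - 1)) * ((p : ℝ) ^ 0 * (p : ℝ) ^ ((n - 1) * (j - (0 + 1)))) := by gcongr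
    _ = 3 * (p : ℝ) ^ (j * (n - 1)) := by
      obtain ⟨i, rfl⟩ : ∃ i, j = i + 1 := ⟨j - 1, by omega⟩
      rw [Nat.zero_add, Nat.add_sub_cancel, pow_zero, one_mul, mul_assoc, ← pow_add]
      congr 2
      ring

include hF hg hid in
-- Lift from modulus p. As R is 1 or p, the sum modulo p is either a plain zero count or the one in
-- `sum_sqrt_hessKer_le`.
theorem sum_primitive_sqrt_hessKer_le (hn : 0 < n) {p j M R : ℕ} [hp : Fact p.Prime] [NeZero M]
    [NeZero R] (hpD : ¬ (p : ℤ) ∣ 2 * D) (hj : 1 ≤ j) (hM : M = p ^ j) (hRp : R ∣ p) (hRM : R ∣ M) :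
    (∑ u : Fin n → ZMod M, if aeval u F = 0 ∧ ∃ i, IsUnit (u i) then
        √(hessKer F (reduceVec hRM u) : ℝ) else 0) ≤
      (3 * (N + 2) ^ n : ℕ) * (M : ℝ) ^ (n - 1) * √R := by
  have hpM : p ∣ M := by rw [hM]; exact dvd_pow_self p (by omega)
  have hp0 : (0 : ℝ) < p := by exact_mod_cast hp.out.pos
  have h1 := sum_primitive_zeros_le hid (e := 0) hp.out hj hM (pow_one p).symm hpM
    (fun h => hpD (h.mul_left 2)) (fun u => √(hessKer F (reduceVec hRp u) : ℝ))
    fun _ => Real.sqrt_nonneg _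
  simp only [reduceVec_reduceVec] at h1
  have h2 : ∑ u : Fin n → ZMod p, (if aeval u F = 0 then √(hessKer F (reduceVec hRp u) : ℝ) else 0) ≤
      (3 * (N + 2) ^ n : ℕ) * (p : ℝ) ^ (n - 1) * √R := by
    rcases (Nat.dvd_prime hp.out).1 hRp with rfl | rfl
    · refine (sum_le_sum (g := fun u : Fin n → ZMod p => if aeval u F = 0 then (1 : ℝ) else 0)
        fun u _ => ?_).trans ?_
      · have := hessKer_le F (reduceVec hRp u)
        rw [one_pow] at this
        split_ifs
        · refine Real.sqrt_le_one.2 ?_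
          exact_mod_cast this
        · exact le_rfl
      · have h3 : (#{u : Fin n → ZMod p | aeval u F = 0} : ℝ) * p ≤ 3 * p ^ (n - 1) * p := by
          rw [mul_assoc, ← pow_succ, Nat.sub_add_cancel hn]
          exact_mod_cast card_zeros_prime_le hF hid hn fun h => hpD (h.mul_left 2)
        rw [← sum_filter, sum_const, nsmul_eq_mul, mul_one, Nat.cast_one, Real.sqrt_one, mul_one]
        refine (le_of_mul_le_mul_right h3 hp0).trans ?_
        push_cast
        have : (1 : ℝ) ≤ (N + 2) ^ n := one_le_pow₀ (by linarith [(Nat.cast_nonneg N : (0 : ℝ) ≤ N)])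
        gcongr
        linarith
    · have h3 : ∀ u : Fin n → ZMod R, reduceVec hRp u = u := by
        intro u
        funext i
        simp
      simp only [h3]
      exact sum_sqrt_hessKer_le hF hg hid hn hpD
  refine h1.trans ((mul_le_mul_of_nonneg_right h2 (by positivity)).trans (le_of_eq ?_))
  obtain ⟨i, rfl⟩ : ∃ i, j = i + 1 := ⟨j - 1, by omega⟩
  rw [hM]
  push_cast
  rw [pow_zero, ← pow_mul, add_mul i, mul_comm i, pow_add]
  ring

include hF hg hid in
-- Imprimitive zeros carry the trivial weight R^(n/2), and their saving p^(n-3) absorbs R^((n-1)/2)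
-- because n - 1 ≤ 2(n - 3), that is, n ≥ 5.
theorem hessWeightedCount_le_of_not_dvd (hn : 5 ≤ n) {p j M R : ℕ} [hp : Fact p.Prime] [NeZero M]
    [NeZero R] (hpD : ¬ (p : ℤ) ∣ 2 * D) (hj : 1 ≤ j) (hM : M = p ^ j) (hRp : R ∣ p) (hRM : R ∣ M) :
    hessWeightedCount F hRM ≤ (3 * (N + 2) ^ n + 6 : ℕ) * (M : ℝ) ^ (n - 1) * √R := by
  have h1 := sum_primitive_sqrt_hessKer_le hF hg hid (by omega) hpD hj hM hRp hRM
  have hp1 : (1 : ℝ) ≤ p := by exact_mod_cast hp.out.one_le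
  have hRp' : (R : ℝ) ≤ p := by exact_mod_cast Nat.le_of_dvd hp.out.pos hRp
  have h2 : √((R : ℝ) ^ n) ≤ (p : ℝ) ^ (n - 3) * √R := by
    refine sqrt_pow_le (Nat.cast_nonneg R) (by positivity) (by omega) ?_
    calc (R : ℝ) ^ (n - 1) ≤ (p : ℝ) ^ (n - 1) := by gcongr
      _ ≤ (p : ℝ) ^ ((n - 3) * 2) := pow_le_pow_right₀ hp1 (by omega)
      _ = _ := pow_mul _ _ _
  have hP : ∀ i, 1 ≤ i → (primitiveZeroCountMod F (p ^ i) : ℝ) ≤ 3 * (p : ℝ) ^ (i * (n - 1)) :=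
    fun i hi => primitiveZeroCountMod_le_of_not_dvd hF hid (by omega) hi fun h => hpD (h.mul_left 2)
  subst hM
  have h3 := imprimitiveZeroCountMod_mul_le hF (by omega) (by norm_num) hj
    fun i _ => zeroCountMod_le hF (by omega) (by norm_num) hP i
  refine (hessWeightedCount_le_primitive_add F hRM).trans ?_
  calc _ ≤ (3 * (N + 2) ^ n : ℕ) * ((p ^ j : ℕ) : ℝ) ^ (n - 1) * √R +
        imprimitiveZeroCountMod F (p ^ j) * ((p : ℝ) ^ (n - 3) * √R) := by gcongr
    _ = (3 * (N + 2) ^ n : ℕ) * ((p ^ j : ℕ) : ℝ) ^ (n - 1) * √R +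
        imprimitiveZeroCountMod F (p ^ j) * (p : ℝ) ^ (n - 3) * √R := by ring
    _ ≤ (3 * (N + 2) ^ n : ℕ) * ((p ^ j : ℕ) : ℝ) ^ (n - 1) * √R +
        (2 * 3 * (p : ℝ) ^ (j * (n - 1))) * √R := by gcongr
    _ = _ := by
      push_cast
      rw [pow_mul]
      ring

include hF hid in
-- For bad primes any constant depending on p will do. With e = |D| one has p^(e+1) > |D|, so Hensel
-- lifting works from modulus p^(e+1), where everything is bounded trivially.
theorem hessWeightedCount_le_of_prime (hn : 4 ≤ n) (hD : D ≠ 0) {p j M R : ℕ} [hp : Fact p.Prime]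
    [NeZero M] [NeZero R] (hM : M = p ^ j) (hRp : R ∣ p) (hRM : R ∣ M) :
    hessWeightedCount F hRM ≤
      2 * (p : ℝ) ^ (n * (D.natAbs + 1) + D.natAbs) * (p : ℝ) ^ n * (M : ℝ) ^ (n - 1) * √R := by
  set e := D.natAbs with he
  have hp1 : (1 : ℝ) ≤ p := by exact_mod_cast hp.out.one_le
  have hRp' : (R : ℝ) ≤ p := by exact_mod_cast Nat.le_of_dvd hp.out.pos hRp
  have hqD : ¬ ((p ^ (e + 1) : ℕ) : ℤ) ∣ D := by
    rw [Int.natCast_dvd, ← he]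
    intro h
    have h1 := Nat.le_of_dvd (Int.natAbs_pos.2 hD) h
    have h2 := Nat.lt_pow_self (n := e + 1) hp.out.one_lt
    omega
  have htriv : ∀ i, (zeroCountMod F (p ^ i) : ℝ) ≤ (p : ℝ) ^ (n * i) := by
    intro i
    have : zeroCountMod F (p ^ i) ≤ p ^ (n * i) := by
      refine (card_le_univ _).trans (le_of_eq ?_)
      simp [ZMod.card, ← pow_mul, mul_comm]
    exact_mod_cast this
  have hP : ∀ i, 1 ≤ i → (primitiveZeroCountMod F (p ^ i) : ℝ) ≤
      (p : ℝ) ^ (n * (e + 1) + e) * (p : ℝ) ^ (i * (n - 1)) := by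
    intro i _
    rcases le_or_gt (e + 1) i with h | h
    · refine (primitiveZeroCountMod_le_zeroCountMod_mul hid (M := p ^ i) (q := p ^ (e + 1))
        hp.out h rfl rfl hqD).trans ?_
      refine (mul_le_mul_of_nonneg_right (htriv (e + 1)) (by positivity)).trans ?_
      rw [pow_add, mul_assoc]
      refine mul_le_mul_of_nonneg_left (mul_le_mul_of_nonneg_left ?_ (by positivity)) (by positivity)
      rw [mul_comm i]
      exact pow_le_pow_right₀ hp1 (Nat.mul_le_mul_left _ (Nat.sub_le _ _))
    · have h1 : (primitiveZeroCountMod F (p ^ i) : ℝ) ≤ zeroCountMod F (p ^ i) := by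
        rw [zeroCountMod_eq]
        push_cast
        linarith [(Nat.cast_nonneg (imprimitiveZeroCountMod F (p ^ i)) : (0 : ℝ) ≤ _)]
      refine h1.trans ((htriv i).trans ?_)
      rw [← pow_add]
      refine pow_le_pow_right₀ hp1 ?_
      have : n * i ≤ n * (e + 1) := Nat.mul_le_mul_left n h.le
      omega
  have hN := zeroCountMod_le hF hn (one_le_pow₀ hp1) hP j
  have h2 : √((R : ℝ) ^ n) ≤ (p : ℝ) ^ n * √R := by
    refine sqrt_pow_le (Nat.cast_nonneg R) (by positivity) (by omega) ?_
    calc (R : ℝ) ^ (n - 1) ≤ (p : ℝ) ^ (n - 1) := by gcongr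
      _ ≤ (p : ℝ) ^ (n * 2) := pow_le_pow_right₀ hp1 (by omega)
      _ = _ := pow_mul _ _ _
  subst hM
  refine (hessWeightedCount_le_zeroCountMod_mul F hRM).trans ?_
  calc _ ≤ (2 * (p : ℝ) ^ (n * (e + 1) + e) * (p : ℝ) ^ (j * (n - 1))) * ((p : ℝ) ^ n * √R) := by
        gcongr
    _ = _ := by
      push_cast
      rw [pow_mul]
      ring

include hF hg hid in
theorem exists_hessWeightedCount_prime_pow_le (hn : 5 ≤ n) (hD : D ≠ 0) :
    ∃ (A : ℝ) (c : ℕ → ℝ), (∀ p, 1 ≤ c p) ∧ (∀ p : ℕ, ¬ (p : ℤ) ∣ 2 * D → c p ≤ A) ∧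
      ∀ (p j M R : ℕ) [NeZero M] [NeZero R] (hRM : R ∣ M), p.Prime → 1 ≤ j → M = p ^ j → R ∣ p →
        hessWeightedCount F hRM ≤ c p * (M : ℝ) ^ (n - 1) * √R := by
  refine ⟨(3 * (N + 2) ^ n + 6 : ℕ), fun p => if (p : ℤ) ∣ 2 * D then
    2 * (p : ℝ) ^ (n * (D.natAbs + 1) + D.natAbs) * (p : ℝ) ^ n else (3 * (N + 2) ^ n + 6 : ℕ),
    fun p => ?_, fun p hp => ?_, ?_⟩
  · dsimp only
    split_ifs with h
    · have hp : p ≠ 0 := by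
        rintro rfl
        rw [Nat.cast_zero, zero_dvd_iff] at h
        omega
      have hp1 : (1 : ℝ) ≤ p := by exact_mod_cast Nat.one_le_iff_ne_zero.2 hp
      have h1 := one_le_pow₀ (n := n * (D.natAbs + 1) + D.natAbs) hp1
      have h2 := one_le_pow₀ (n := n) hp1
      nlinarith
    · exact_mod_cast (by omega : 1 ≤ 3 * (N + 2) ^ n + 6)
  · simp only [if_neg hp, le_refl]
  · intro p j M R _ _ hRM hp hj hM hRp
    have : Fact p.Prime := ⟨hp⟩
    dsimp only
    split_ifs with h
    · exact hessWeightedCount_le_of_prime hF hid (by omega) hD hM hRp hRM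
    · exact hessWeightedCount_le_of_not_dvd hF hg hid hn h hj hM hRp hRM

end LocalBound

/-! ### From prime powers to general moduli -/

section Multiplicativity
open Finset
open scoped Classical

variable {n : ℕ}

theorem reduceVec_prod_injective {a b c : ℕ} [NeZero c] (hab : Nat.Coprime a b) (hc : c ∣ a * b)
    (ha : a ∣ c) (hb : b ∣ c) :
    Function.Injective fun u : Fin n → ZMod c => (reduceVec ha u, reduceVec hb u) := by
  intro u v h
  simp only [Prod.mk.injEq] at h
  funext i
  rw [← sub_eq_zero]
  have h1 : a ∣ (u i - v i).val := by
    rw [← castHom_eq_zero_iff_dvd_val ha, map_sub, sub_eq_zero]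
    exact congrFun h.1 i
  have h2 : b ∣ (u i - v i).val := by
    rw [← castHom_eq_zero_iff_dvd_val hb, map_sub, sub_eq_zero]
    exact congrFun h.2 i
  rw [← ZMod.natCast_zmod_val (u i - v i), ZMod.natCast_eq_zero_iff]
  exact hc.trans (hab.mul_dvd_of_dvd_of_dvd h1 h2)

theorem hessKer_le_mul (F : MvPolynomial (Fin n) ℤ) {a b c : ℕ} [NeZero a] [NeZero b] [NeZero c]
    (hab : Nat.Coprime a b) (hc : c ∣ a * b) (ha : a ∣ c) (hb : b ∣ c) (u : Fin n → ZMod c) :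
    hessKer F u ≤ hessKer F (reduceVec ha u) * hessKer F (reduceVec hb u) := by
  rw [hessKer, hessKer, hessKer, ← card_product]
  refine card_le_card_of_injOn _ ?_ (reduceVec_prod_injective hab hc ha hb).injOn
  intro d hd
  simp only [coe_filter, mem_univ, true_and, Set.mem_ofPred_eq] at hd
  simp only [coe_product, coe_filter, mem_univ, true_and, Set.mem_prod, Set.mem_ofPred_eq,
    hessMul_reduceVec, hd, map_zero, implies_true, and_self]

theorem sum_mul_le_of_injective {α β γ : Type*} [Fintype α] [Fintype β] [Fintype γ] {f : α → β}
    {g : α → γ} (h : Function.Injective fun x => (f x, g x)) {v : β → ℝ} {w : γ → ℝ}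
    (hv : ∀ y, 0 ≤ v y) (hw : ∀ z, 0 ≤ w z) :
    ∑ x, v (f x) * w (g x) ≤ (∑ y, v y) * ∑ z, w z := by
  rw [sum_mul_sum, ← Fintype.sum_prod_type', ← sum_image (s := univ) (g := fun x => (f x, g x))
    (f := fun x : β × γ => v x.1 * w x.2) h.injOn]
  exact sum_le_univ_sum_of_nonneg fun x => mul_nonneg (hv _) (hw _)

/-- Only an upper bound is needed, so injectivity of the Chinese remainder map suffices, both for
zeros and for Hessian kernels. -/
theorem hessWeightedCount_le_mul (F : MvPolynomial (Fin n) ℤ) {M a b R r s : ℕ} [NeZero M]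
    [NeZero a] [NeZero b] [NeZero R] [NeZero r] [NeZero s] (hab : Nat.Coprime a b) (hM : M = a * b)
    (hR : R = r * s) (hRM : R ∣ M) (hra : r ∣ a) (hsb : s ∣ b) :
    hessWeightedCount F hRM ≤ hessWeightedCount F hra * hessWeightedCount F hsb := by
  have haM : a ∣ M := hM ▸ dvd_mul_right a b
  have hbM : b ∣ M := hM ▸ dvd_mul_left b a
  have hrR : r ∣ R := hR ▸ dvd_mul_right r s
  have hsR : s ∣ R := hR ▸ dvd_mul_left s r
  rw [hessWeightedCount, hessWeightedCount, hessWeightedCount]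
  refine le_trans (sum_le_sum fun u _ => ?_) (sum_mul_le_of_injective
    (reduceVec_prod_injective hab (dvd_of_eq hM) haM hbM) (fun u => ?_) fun u => ?_)
  · rw [aeval_reduceVec, aeval_reduceVec, reduceVec_reduceVec, reduceVec_reduceVec]
    by_cases h : aeval u F = 0
    · rw [h, map_zero, map_zero, if_pos rfl, if_pos rfl, if_pos rfl,
        ← Real.sqrt_mul (Nat.cast_nonneg _)]
      have h2 := hessKer_le_mul F ((hab.coprime_dvd_left hra).coprime_dvd_right hsb)
        (dvd_of_eq hR) hrR hsR (reduceVec hRM u)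
      rw [reduceVec_reduceVec, reduceVec_reduceVec] at h2
      exact Real.sqrt_le_sqrt (by exact_mod_cast h2)
    · rw [if_neg h]
      positivity
  · positivity
  · positivity

/-- Squarefreeness of R ensures that its part at each prime p divides p, as the local bound
requires. -/
theorem hessWeightedCount_le_prod {F : MvPolynomial (Fin n) ℤ} {c : ℕ → ℝ}
    (hloc : ∀ (p j M R : ℕ) [NeZero M] [NeZero R] (hRM : R ∣ M), p.Prime → 1 ≤ j → M = p ^ j →
      R ∣ p → hessWeightedCount F hRM ≤ c p * (M : ℝ) ^ (n - 1) * √R)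
    (M : ℕ) : ∀ [NeZero M] (R : ℕ) [NeZero R] (hRM : R ∣ M), Squarefree R →
      hessWeightedCount F hRM ≤ (∏ p ∈ M.primeFactors, c p) * (M : ℝ) ^ (n - 1) * √R := by
  induction M using Nat.recOnPosPrimePosCoprime with
  | zero => exact fun {h} => absurd rfl h.out
  | one =>
    intro _ R _ hRM _
    have h1 := hessWeightedCount_le_zeroCountMod_mul F hRM
    have h2 : zeroCountMod F 1 ≤ 1 := (card_le_univ _).trans (le_of_eq (by simp))
    have h3 : (zeroCountMod F 1 : ℝ) ≤ 1 := by exact_mod_cast h2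
    obtain rfl := Nat.dvd_one.1 hRM
    simp only [Nat.cast_one, one_pow, Real.sqrt_one, mul_one] at h1
    simpa using h1.trans h3
  | prime_pow p j hp hj =>
    intro _ R _ hRM hR
    have := hloc p j (p ^ j) R hRM hp hj rfl ((hR.dvd_pow_iff_dvd hj.ne').1 hRM)
    rwa [Nat.primeFactors_prime_pow hj.ne' hp, prod_singleton]
  | coprime a b ha hb hab iha ihb =>
    intro _ R _ hRM hR
    have : NeZero a := ⟨by omega⟩
    have : NeZero b := ⟨by omega⟩
    have hRrs : R = R.gcd a * R.gcd b := by
      rw [← hab.gcd_mul, Nat.gcd_eq_left hRM]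
    have : NeZero (R.gcd a) := ⟨(Nat.gcd_pos_of_pos_right _ (by omega)).ne'⟩
    have : NeZero (R.gcd b) := ⟨(Nat.gcd_pos_of_pos_right _ (by omega)).ne'⟩
    have h1 := iha (R.gcd a) (Nat.gcd_dvd_right _ _) (hR.squarefree_of_dvd (Nat.gcd_dvd_left _ _))
    have h2 := ihb (R.gcd b) (Nat.gcd_dvd_right _ _) (hR.squarefree_of_dvd (Nat.gcd_dvd_left _ _))
    have h3 := hessWeightedCount_le_mul F hab rfl hRrs hRM (Nat.gcd_dvd_right _ _)
      (Nat.gcd_dvd_right _ _)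
    have hnonneg : 0 ≤ hessWeightedCount F (Nat.gcd_dvd_right R b) :=
      sum_nonneg fun u _ => by positivity
    have hsqrt : √(R : ℝ) = √(R.gcd a : ℝ) * √(R.gcd b : ℝ) := by
      rw [← Real.sqrt_mul (Nat.cast_nonneg _), ← Nat.cast_mul, ← hRrs]
    refine h3.trans ((mul_le_mul h1 h2 hnonneg (le_trans (sum_nonneg fun u _ => by positivity) h1)).trans
      (le_of_eq ?_))
    rw [hab.primeFactors_mul, prod_union hab.disjoint_primeFactors, hsqrt]
    push_cast
    ring

/-- Outside a finite set c p ≤ A ≤ p ^ ε, and the product of the primes dividing k is at most k; the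
finite set contributes the constant. -/
theorem exists_prod_primeFactors_le {c : ℕ → ℝ} (hc : ∀ p, 1 ≤ c p) {A : ℝ} (S : Finset ℕ)
    (hA : ∀ p ∉ S, c p ≤ A) {ε : ℝ} (hε : 0 < ε) :
    ∃ K : ℝ, 0 ≤ K ∧ ∀ k : ℕ, k ≠ 0 → ∏ p ∈ k.primeFactors, c p ≤ K * (k : ℝ) ^ ε := by
  obtain ⟨P, hP⟩ := Filter.eventually_atTop.1
    (((tendsto_rpow_atTop hε).comp tendsto_natCast_atTop_atTop).eventually_ge_atTop A)
  set T := S ∪ range P with hT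
  have hc0 : ∀ p, 0 ≤ c p := fun p => zero_le_one.trans (hc p)
  have hcT : ∀ p ∉ T, c p ≤ (p : ℝ) ^ ε := by
    intro p hp
    rw [hT, mem_union, not_or, mem_range, not_lt] at hp
    exact (hA p hp.1).trans (hP p hp.2)
  refine ⟨∏ p ∈ T, c p, prod_nonneg fun p _ => hc0 p, fun k hk => ?_⟩
  rw [← prod_filter_mul_prod_filter_not k.primeFactors (fun p => p ∈ T)]
  refine mul_le_mul ?_ ?_ (prod_nonneg fun p _ => hc0 p) (prod_nonneg fun p _ => hc0 p)
  · refine prod_le_prod_of_subset_of_one_le ?_ (fun p _ => hc0 p) fun p _ _ => hc p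
    exact fun p hp => (mem_filter.1 hp).2
  · calc ∏ p ∈ k.primeFactors with p ∉ T, c p
        ≤ ∏ p ∈ k.primeFactors with p ∉ T, (p : ℝ) ^ ε :=
          prod_le_prod (fun p _ => hc0 p) fun p hp => hcT p (mem_filter.1 hp).2
      _ ≤ ∏ p ∈ k.primeFactors, (p : ℝ) ^ ε := by
          refine prod_le_prod_of_subset_of_one_le (filter_subset _ _) (fun p _ => by positivity) fun p hp _ => ?_
          exact Real.one_le_rpow (by exact_mod_cast (Nat.prime_of_mem_primeFactors hp).one_le) hε.le
      _ = (∏ p ∈ k.primeFactors, (p : ℝ)) ^ ε :=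
          Real.finsetProd_rpow _ _ (fun p _ => Nat.cast_nonneg p) _
      _ ≤ (k : ℝ) ^ ε := by
          refine Real.rpow_le_rpow (prod_nonneg fun p _ => Nat.cast_nonneg p) ?_ hε.le
          rw [← Nat.cast_prod]
          exact Nat.cast_le.2 (Nat.le_of_dvd (Nat.pos_of_ne_zero hk) (Nat.prod_primeFactors_dvd k))

theorem exists_hessWeightedCount_le {F : MvPolynomial (Fin n) ℤ} (hF : F.IsHomogeneous 3)
    (hns : NonsingularForm F) (hn : 5 ≤ n) {ε : ℝ} (hε : 0 < ε) :
    ∃ K : ℝ, 0 ≤ K ∧ ∀ (M R : ℕ) [NeZero M] [NeZero R] (hRM : R ∣ M), Squarefree R →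
      hessWeightedCount F hRM ≤ K * (M : ℝ) ^ ε * (M : ℝ) ^ (n - 1) * √R := by
  obtain ⟨D, hD, N, g, hg, hid⟩ := exists_pow_mem_gradient_ideal hF hns
  obtain ⟨A, c, hc, hA, hloc⟩ := exists_hessWeightedCount_prime_pow_le hF hg hid hn hD
  obtain ⟨K, hK, hprod⟩ := exists_prod_primeFactors_le hc (2 * D).natAbs.divisors (A := A)
    (fun p hp => hA p fun h => hp (by
      rw [Nat.mem_divisors]
      exact ⟨Int.natCast_dvd.1 h, by simpa using hD⟩)) hε
  refine ⟨K, hK, fun M R _ _ hRM hR => (hessWeightedCount_le_prod hloc M R hRM hR).trans ?_⟩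
  gcongr
  exact hprod M (NeZero.ne M)

end Multiplicativity

/-! ### Residue classes, exponents and the final estimates -/

section Assembly
open Finset
open scoped Classical

variable {n : ℕ}

theorem card_Icc_filter_intCast_eq_le {a : ℤ} (ha : 0 ≤ a) {M : ℕ} [NeZero M] (b : ZMod M) :
    (#{z ∈ Icc (-a) a | ((z : ℤ) : ZMod M) = b} : ℝ) ≤ 2 * a / M + 1 := by
  have hM : (0 : ℤ) < M := by exact_mod_cast NeZero.pos M
  have h1 : #{z ∈ Icc (-a) a | ((z : ℤ) : ZMod M) = b} ≤ #(Icc 0 (2 * a / M)) := by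
    refine card_le_card_of_injOn (fun z => (z + a) / M) (fun z hz => ?_) fun z hz w hw h => ?_
    · simp only [coe_filter, mem_Icc, Set.mem_ofPred_eq] at hz
      simp only [coe_Icc, Set.mem_Icc]
      exact ⟨Int.ediv_nonneg (by linarith) hM.le, Int.ediv_le_ediv hM (by linarith)⟩
    · simp only [coe_filter, mem_Icc, Set.mem_ofPred_eq] at hz hw
      have h2 : (z + a) % M = (w + a) % M := by
        have := hz.2.trans hw.2.symm
        rw [ZMod.intCast_eq_intCast_iff] at this
        exact Int.ModEq.add_right a this
      have h3 := Int.emod_add_mul_ediv (z + a) M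
      have h4 := Int.emod_add_mul_ediv (w + a) M
      simp only at h
      rw [h2, h] at h3
      linarith
  have h5 : (0 : ℤ) ≤ 2 * a / M := Int.ediv_nonneg (by linarith) hM.le
  rw [Int.card_Icc] at h1
  have h6 : ((2 * a / M + 1 - 0).toNat : ℤ) = 2 * a / M + 1 := by omega
  have h7 : ((2 * a / M : ℤ) : ℝ) ≤ 2 * a / M := by
    rw [le_div_iff₀ (by exact_mod_cast hM)]
    exact_mod_cast Int.ediv_mul_le (2 * a) hM.ne'
  calc (#{z ∈ Icc (-a) a | ((z : ℤ) : ZMod M) = b} : ℝ) ≤ ((2 * a / M + 1 - 0).toNat : ℝ) := by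
        exact_mod_cast h1
    _ = ((2 * a / M : ℤ) : ℝ) + 1 := by exact_mod_cast h6
    _ ≤ _ := by linarith

theorem eval_intCast_eq_zero_iff (F : MvPolynomial (Fin n) ℤ) (m : Fin n → ℤ) :
    eval (fun i => (m i : ℚ)) (map (Int.castRingHom ℚ) F) = 0 ↔ eval m F = 0 := by
  have h : eval (fun i => (m i : ℚ)) (map (Int.castRingHom ℚ) F) = ((eval m F : ℤ) : ℚ) := by
    rw [eval_map, ← eq_intCast (Int.castRingHom ℚ), eval, coe_eval₂Hom, hom_eval₂]
    rfl
  rw [h, Int.cast_eq_zero]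

/-- A bound for points in boxes of a rational point set gives a bound for the integral points in
a residue class. -/
theorem card_intBox_residue_le (p : (Fin n → ℚ) → Prop) {c e : ℕ} (he : e ≤ n)
    (hp : ∀ (T : ℕ) (A : Fin n → Finset ℚ), (∀ i, #(A i) ≤ T) →
      #{x ∈ Fintype.piFinset A | p x} * T ^ e ≤ c * T ^ n)
    {y : ℝ} (hy : 0 ≤ y) {M : ℕ} [NeZero M] (b : Fin n → ZMod M) :
    (#{m ∈ intBox n y | p (fun i => (m i : ℚ)) ∧ ∀ i, (m i : ZMod M) = b i} : ℝ) ≤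
      c * (2 * y / M + 1) ^ (n - e) := by
  have hfl : 0 ≤ ⌊y⌋ := Int.floor_nonneg.2 hy
  have hM : (0 : ℝ) < M := by exact_mod_cast NeZero.pos M
  set T := ⌊2 * y / M + 1⌋₊ with hT
  have hT1 : 1 ≤ T := Nat.le_floor (by push_cast; linarith [show 0 ≤ 2 * y / M by positivity])
  have hTle : (T : ℝ) ≤ 2 * y / M + 1 := Nat.floor_le (by positivity)
  -- A residue class in the box is again a product of finite sets with at most T elements each; this
  -- is why zeros are counted in products of arbitrary finite sets.
  set B : Fin n → Finset ℤ := fun i => {z ∈ Icc (-⌊y⌋) ⌊y⌋ | (z : ZMod M) = b i} with hB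
  have hcard : ∀ i, #((B i).image (Int.cast : ℤ → ℚ)) ≤ T := by
    intro i
    refine card_image_le.trans (Nat.le_floor ((card_Icc_filter_intCast_eq_le hfl (b i)).trans ?_))
    gcongr
    exact Int.floor_le y
  have h1 := hp T (fun i => (B i).image Int.cast) hcard
  have h2 : #{m ∈ intBox n y | p (fun i => (m i : ℚ)) ∧ ∀ i, (m i : ZMod M) = b i} ≤
      #{x ∈ Fintype.piFinset fun i => (B i).image (Int.cast : ℤ → ℚ) | p x} := by
    refine card_le_card_of_injOn (fun m i => (m i : ℚ)) (fun m hm => ?_) fun m _ m' _ h => ?_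
    · simp only [coe_filter, intBox, Fintype.mem_piFinset, Set.mem_ofPred_eq] at hm
      simp only [coe_filter, Fintype.mem_piFinset, Set.mem_ofPred_eq, mem_image, hB, mem_filter]
      exact ⟨fun i => ⟨m i, ⟨hm.1 i, hm.2.2 i⟩, rfl⟩, hm.2.1⟩
    · funext i
      exact Int.cast_injective (congrFun h i)
  have h3 : #{m ∈ intBox n y | p (fun i => (m i : ℚ)) ∧ ∀ i, (m i : ZMod M) = b i} ≤
      c * T ^ (n - e) := by
    refine Nat.le_of_mul_le_mul_right ?_ (pow_pos hT1 e)
    rw [mul_assoc, ← pow_add, Nat.sub_add_cancel he]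
    exact (Nat.mul_le_mul_right _ h2).trans h1
  calc _ ≤ ((c * T ^ (n - e) : ℕ) : ℝ) := Nat.cast_le.2 h3
    _ = c * (T : ℝ) ^ (n - e) := by push_cast; rfl
    _ ≤ _ := by gcongr

theorem add_one_pow_le {x : ℝ} (hx : 0 ≤ x) (f : ℕ) : (2 * x + 1) ^ f ≤ 4 ^ f * (1 + x ^ f) := by
  rcases le_total x 1 with h | h
  · calc (2 * x + 1) ^ f ≤ 4 ^ f := by gcongr; linarith
      _ ≤ 4 ^ f * (1 + x ^ f) := le_mul_of_one_le_right (by positivity) (by linarith [pow_nonneg hx f])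
  · calc (2 * x + 1) ^ f ≤ (4 * x) ^ f := by gcongr; linarith
      _ = 4 ^ f * x ^ f := mul_pow _ _ _
      _ ≤ _ := by gcongr; linarith

theorem NonsingularForm.two_mul {C : MvPolynomial (Fin n) ℤ} (h : NonsingularForm C) :
    NonsingularForm (MvPolynomial.C 2 * C) := by
  intro x hx
  refine h x fun i => ?_
  have := hx i
  rw [pderiv_C_mul, map_mul, aeval_C] at this
  simpa using this

theorem sqrt_pow_mul_sqrt {R : ℝ} (hR : 0 ≤ R) (n : ℕ) :
    √(2 * R ^ (n + 3)) * √R = √2 * R ^ ((n : ℝ) / 2 + 2) := by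
  rw [Real.sqrt_mul (by norm_num), mul_assoc, ← Real.sqrt_mul (by positivity), ← pow_succ,
    Real.sqrt_eq_rpow (R ^ _), ← Real.rpow_natCast, ← Real.rpow_mul hR]
  congr 2
  push_cast
  ring

/-- The bound for the exponential sums over the integral points of a thin set. -/
theorem exists_sum_norm_expSumQ_le (hn : 5 ≤ n) {C : MvPolynomial (Fin n) ℤ}
    (hC : C.IsHomogeneous 3) (hns : NonsingularForm C) {ε : ℝ} (hε : 0 < ε)
    (p : (Fin n → ℚ) → Prop) {c e : ℕ} (he : e ≤ n)
    (hp : ∀ (T : ℕ) (A : Fin n → Finset ℚ), (∀ i, #(A i) ≤ T) →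
      #{x ∈ Fintype.piFinset A | p x} * T ^ e ≤ c * T ^ n) :
    ∃ K : ℝ, 0 ≤ K ∧ ∀ k M R : ℕ, 0 < k → k = M ^ 2 * R → R ∣ M → Squarefree R →
      ∀ y : ℝ, 0 ≤ y → ∑ m ∈ intBox n y with p (fun i => (m i : ℚ)), ‖expSumQ C (appendZero m) k‖ ≤
        K * (k : ℝ) ^ ε * ((M : ℝ) ^ (2 * n + 2) * (R : ℝ) ^ ((n : ℝ) / 2 + 2) *
          (1 + (y / M) ^ (n - e))) := by
  have hC2 : (MvPolynomial.C 2 * C).IsHomogeneous 3 := hC.C_mul 2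
  obtain ⟨K, hK, hbound⟩ := exists_hessWeightedCount_le hC2 hns.two_mul hn hε
  refine ⟨√2 * c * 4 ^ (n - e) * 2 * K, by positivity, fun k M R hk hkMR hRM hR y hy => ?_⟩
  have hM0 : M ≠ 0 := by rintro rfl; simp [hkMR] at hk
  have : NeZero k := ⟨hk.ne'⟩
  have : NeZero M := ⟨hM0⟩
  have : NeZero R := ⟨hR.ne_zero⟩
  have hMk : (M : ℝ) ≤ k := by
    exact_mod_cast Nat.le_of_dvd hk (hkMR ▸ (dvd_pow_self M two_ne_zero).mul_right R)
  have h1 := sum_norm_expSumQ_le hkMR hRM C {m ∈ intBox n y | p (fun i => (m i : ℚ))}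
    (c * (4 ^ (n - e) * (1 + (y / M) ^ (n - e)))) fun b => by
      rw [filter_filter]
      refine (card_intBox_residue_le p he hp hy b).trans ?_
      rw [mul_div_assoc]
      gcongr
      exact add_one_pow_le (by positivity) _
  refine h1.trans ?_
  calc _ ≤ (M : ℝ) ^ (n + 2) * √(2 * (R : ℝ) ^ (n + 3)) * (c * (4 ^ (n - e) * (1 + (y / M) ^ (n - e))) *
        (2 * M * (K * (k : ℝ) ^ ε * (M : ℝ) ^ (n - 1) * √R))) := by
        gcongr
        refine (hbound M R hRM hR).trans ?_
        gcongr
    _ = (√(2 * (R : ℝ) ^ (n + 3)) * √R) * ((M : ℝ) ^ (n + 2) * M * (M : ℝ) ^ (n - 1)) *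
          (c * (4 ^ (n - e) * (1 + (y / M) ^ (n - e))) * (2 * (K * (k : ℝ) ^ ε))) := by ring
    _ = _ := by
        rw [sqrt_pow_mul_sqrt (Nat.cast_nonneg R), ← pow_succ, ← pow_add,
          show n + 2 + 1 + (n - 1) = 2 * n + 2 by omega]
        ring

/-- If a prime p divided R but not M, then p³ ∣ k would force p² ∣ R, against squarefreeness. -/
theorem CubeFull.exists_sq_mul_squarefree {k : ℕ} (hk : CubeFull k) :
    ∃ M R : ℕ, k = M ^ 2 * R ∧ R ∣ M ∧ Squarefree R := by
  obtain ⟨R, M, hMR, hR⟩ := Nat.sq_mul_squarefree k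
  refine ⟨M, R, hMR.symm, ?_, hR⟩
  rw [← Nat.prod_primeFactors_of_squarefree hR]
  refine prod_primes_dvd _ (fun p hp => (Nat.prime_of_mem_primeFactors hp).prime) fun p hp => ?_
  have hpp := Nat.prime_of_mem_primeFactors hp
  have hpR := Nat.dvd_of_mem_primeFactors hp
  by_contra hpM
  have h3 := hk.2 p hpp (hMR ▸ hpR.mul_left _)
  rw [← hMR] at h3
  have hcop : Nat.Coprime (p ^ 3) (M ^ 2) :=
    Nat.Coprime.pow 3 2 ((Nat.Prime.coprime_iff_not_dvd hpp).2 hpM)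
  have h4 : p * p ∣ R := (Dvd.intro p (by ring : p * p * p = p ^ 3)).trans
    (hcop.dvd_of_dvd_mul_left h3)
  exact hpp.one_lt.ne' (Nat.isUnit_iff.1 (hR p h4))

/-- A prime not dividing R has even exponent in k = M²R, so it cannot have exponent three. -/
theorem exists_exactCubePart_eq {k M R : ℕ} (hk : k ≠ 0) (hkMR : k = M ^ 2 * R) (hRM : R ∣ M) :
    ∃ P : ℕ, exactCubePart k = P ^ 3 ∧ P ∣ R := by
  refine ⟨∏ p ∈ k.primeFactors with k.factorization p = 3, p, prod_pow _ _ _, ?_⟩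
  refine prod_primes_dvd _ (fun p hp => (Nat.prime_of_mem_primeFactors (mem_filter.1 hp).1).prime)
    fun p hp => ?_
  rw [mem_filter] at hp
  have hpp := Nat.prime_of_mem_primeFactors hp.1
  have hM : M ≠ 0 := by rintro rfl; simp [hkMR] at hk
  have hR : R ≠ 0 := by rintro rfl; simp [hkMR] at hk
  by_contra hpR
  have h1 := hp.2
  rw [hkMR, Nat.factorization_mul (pow_ne_zero 2 hM) hR, Nat.factorization_pow, Finsupp.add_apply,
    Nat.factorization_eq_zero_of_not_dvd hpR, Finsupp.smul_apply, smul_eq_mul] at h1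
  omega

/-- Put k₃ = P³, M = PM', R = PR', so l₄ = M'²R'. The powers of P match exactly, as (2n + 2) + (n/2
+ 2) = 3(5n/6 + 4/3); only n/2 + 2 ≤ n + 1 in the exponent of R' is lossy. -/
theorem pow_mul_rpow_le_exactCubePart {k₃ l₄ M R : ℕ} (hn : 2 ≤ n) (hk : k₃ * l₄ ≠ 0)
    (hkMR : k₃ * l₄ = M ^ 2 * R) (hRM : R ∣ M) (hk₃ : k₃ = exactCubePart (k₃ * l₄)) :
    (M : ℝ) ^ (2 * n + 2) * (R : ℝ) ^ ((n : ℝ) / 2 + 2) ≤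
      (k₃ : ℝ) ^ ((5 / 6 : ℝ) * n + 4 / 3) * (l₄ : ℝ) ^ (n + 1) := by
  obtain ⟨P, hP, hPR⟩ := exists_exactCubePart_eq hk hkMR hRM
  rw [← hk₃] at hP
  obtain ⟨M', rfl⟩ := hPR.trans hRM
  obtain ⟨R', rfl⟩ := hPR
  have hP0 : P ≠ 0 := by rintro rfl; simp [hP] at hk
  have hR0 : R' ≠ 0 := by
    rintro rfl
    rw [hkMR] at hk
    simp at hk
  have hl : l₄ = M' ^ 2 * R' := by
    refine Nat.eq_of_mul_eq_mul_left (pow_pos (Nat.pos_of_ne_zero hP0) 3) ?_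
    calc P ^ 3 * l₄ = k₃ * l₄ := by rw [hP]
      _ = _ := by rw [hkMR]; ring
  have hPpos : (0 : ℝ) < P := by exact_mod_cast Nat.pos_of_ne_zero hP0
  have hR1 : (1 : ℝ) ≤ R' := by exact_mod_cast Nat.one_le_iff_ne_zero.2 hR0
  have hn' : (2 : ℝ) ≤ n := by exact_mod_cast hn
  have h1 : (R' : ℝ) ^ ((n : ℝ) / 2 + 2) ≤ (R' : ℝ) ^ (n + 1) := by
    rw [← Real.rpow_natCast]
    refine Real.rpow_le_rpow_of_exponent_le hR1 ?_
    push_cast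
    linarith
  have h2 : ((P : ℝ) ^ 3) ^ ((5 / 6 : ℝ) * n + 4 / 3) =
      (P : ℝ) ^ (2 * n + 2) * (P : ℝ) ^ ((n : ℝ) / 2 + 2) := by
    rw [← Real.rpow_natCast, ← Real.rpow_natCast, ← Real.rpow_mul hPpos.le, ← Real.rpow_add hPpos]
    congr 1
    push_cast
    ring
  rw [hP, hl]
  push_cast
  rw [h2, Real.mul_rpow hPpos.le (by positivity)]
  calc _ = (P : ℝ) ^ (2 * n + 2) * (P : ℝ) ^ ((n : ℝ) / 2 + 2) *
        ((M' : ℝ) ^ (2 * n + 2) * (R' : ℝ) ^ ((n : ℝ) / 2 + 2)) := by ring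
    _ ≤ (P : ℝ) ^ (2 * n + 2) * (P : ℝ) ^ ((n : ℝ) / 2 + 2) *
        ((M' : ℝ) ^ (2 * n + 2) * (R' : ℝ) ^ (n + 1)) := by gcongr
    _ = _ := by ring

/-- After cancelling M^(n-e) there remains M^(n+2+e) R^(n/2+2). Trading R^((2-e)/3) for the same
power of M, by R ≤ M, makes the exponent of M twice that of R, giving a pure power of M²R. -/
theorem pow_mul_rpow_le_modulus {M R e : ℕ} (hR : 0 < R) (hM : 0 < M) (hRM : R ∣ M) (he : e ≤ 2)
    (hen : e ≤ n) {y : ℝ} (hy : 0 ≤ y) :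
    (M : ℝ) ^ (2 * n + 2) * (R : ℝ) ^ ((n : ℝ) / 2 + 2) * (y / M) ^ (n - e) ≤
      y ^ (n - e) * ((M : ℝ) ^ 2 * R) ^ ((n : ℝ) / 2 + 2 - (2 - e) / 3) := by
  have hM0 : (0 : ℝ) < M := by exact_mod_cast hM
  have hR0 : (0 : ℝ) < R := by exact_mod_cast hR
  have hRM' : (R : ℝ) ≤ M := by exact_mod_cast Nat.le_of_dvd hM hRM
  have he' : (e : ℝ) ≤ 2 := by exact_mod_cast he
  have h1 : (M : ℝ) ^ (2 * n + 2) = (M : ℝ) ^ (n + 2 + e) * (M : ℝ) ^ (n - e) := by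
    rw [← pow_add]
    congr 1
    omega
  have h2 : (M : ℝ) ^ (n + 2 + e) * (R : ℝ) ^ ((n : ℝ) / 2 + 2) ≤
      ((M : ℝ) ^ 2 * R) ^ ((n : ℝ) / 2 + 2 - (2 - e) / 3) := by
    rw [Real.mul_rpow (by positivity) hR0.le, ← Real.rpow_natCast, ← Real.rpow_natCast,
      ← Real.rpow_mul hM0.le]
    calc (M : ℝ) ^ ((n + 2 + e : ℕ) : ℝ) * (R : ℝ) ^ ((n : ℝ) / 2 + 2)
        = (M : ℝ) ^ ((n + 2 + e : ℕ) : ℝ) * ((R : ℝ) ^ ((2 - e) / 3 : ℝ) *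
          (R : ℝ) ^ ((n : ℝ) / 2 + 2 - (2 - e) / 3)) := by
          rw [← Real.rpow_add hR0]
          ring_nf
      _ ≤ (M : ℝ) ^ ((n + 2 + e : ℕ) : ℝ) * ((M : ℝ) ^ ((2 - e) / 3 : ℝ) *
          (R : ℝ) ^ ((n : ℝ) / 2 + 2 - (2 - e) / 3)) := by
          gcongr
      _ = _ := by
          rw [← mul_assoc, ← Real.rpow_add hM0]
          congr 2
          push_cast
          ring
  calc _ = y ^ (n - e) * ((M : ℝ) ^ (n + 2 + e) * (R : ℝ) ^ ((n : ℝ) / 2 + 2)) := by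
        rw [h1, div_pow]
        field_simp
    _ ≤ _ := by gcongr

theorem exists_sum_norm_expSumQ_cubeFull_le (hn : 5 ≤ n) {C : MvPolynomial (Fin n) ℤ}
    (hC : C.IsHomogeneous 3) (hns : NonsingularForm C) {ε : ℝ} (hε : 0 < ε)
    (p : (Fin n → ℚ) → Prop) {c e : ℕ} (he : e ≤ 2)
    (hp : ∀ (T : ℕ) (A : Fin n → Finset ℚ), (∀ i, #(A i) ≤ T) →
      #{x ∈ Fintype.piFinset A | p x} * T ^ e ≤ c * T ^ n) :
    ∃ K : ℝ, ∀ k₃ l₄ : ℕ, CubeFull (k₃ * l₄) → k₃ = exactCubePart (k₃ * l₄) → ∀ y : ℝ, 0 ≤ y →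
      ∑ m ∈ intBox n y with p (fun i => (m i : ℚ)), ‖expSumQ C (appendZero m) (k₃ * l₄)‖ ≤
        K * (((k₃ * l₄ : ℕ) : ℝ) ^ ε *
          ((k₃ : ℝ) ^ ((5 / 6 : ℝ) * n + 4 / 3) * (l₄ : ℝ) ^ (n + 1) +
            y ^ (n - e) * ((k₃ * l₄ : ℕ) : ℝ) ^ ((n : ℝ) / 2 + 2 - (2 - e) / 3))) := by
  obtain ⟨K, hK, hbound⟩ := exists_sum_norm_expSumQ_le hn hC hns hε p (by omega : e ≤ n) hp
  refine ⟨K, fun k₃ l₄ hk hk₃ y hy => ?_⟩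
  obtain ⟨M, R, hkMR, hRM, hR⟩ := hk.exists_sq_mul_squarefree
  have hM : 0 < M := by
    rw [Nat.pos_iff_ne_zero]
    rintro rfl
    simpa [hkMR] using hk.1
  refine (hbound _ M R hk.1 hkMR hRM hR y hy).trans ?_
  rw [mul_assoc]
  gcongr
  rw [mul_add, mul_one]
  refine add_le_add (pow_mul_rpow_le_exactCubePart (by omega) hk.1.ne' hkMR hRM hk₃) ?_
  rw [hkMR]
  push_cast
  exact pow_mul_rpow_le_modulus (Nat.pos_of_ne_zero hR.ne_zero) hM hRM he (by omega) hy

end Assembly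

theorem lemma6p2 (n : ℕ) (hn : 6 ≤ n) (C : MvPolynomial (Fin n) ℤ) (hC : C.IsHomogeneous 3)
    (hns : NonsingularForm C) (F₁ : MvPolynomial (Fin n) ℤ) (hF₁ : IsDualForm C F₁)
    (ε : ℝ) (hε : 0 < ε) :
    (∃ K : ℝ, ∀ k₃ l₄ : ℕ, CubeFull (k₃ * l₄) → k₃ = exactCubePart (k₃ * l₄) →
      ∀ y : ℝ, 0 ≤ y →
        ∑ m ∈ (intBox n y).filter (fun m => MvPolynomial.eval m F₁ = 0),
            ‖expSumQ C (appendZero m) (k₃ * l₄)‖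
          ≤ K * (((k₃ * l₄ : ℕ) : ℝ) ^ ε *
            ((k₃ : ℝ) ^ ((5 / 6 : ℝ) * n + 4 / 3) * (l₄ : ℝ) ^ (n + 1)
              + y ^ (n - 1) * ((k₃ * l₄ : ℕ) : ℝ) ^ ((1 / 2 : ℝ) * n + 5 / 3)))) ∧
    (∀ F₂ : MvPolynomial (Fin n) ℤ,
      ¬ MvPolynomial.map (Int.castRingHom ℚ) F₁ ∣ MvPolynomial.map (Int.castRingHom ℚ) F₂ →
      ∃ K : ℝ, ∀ k₃ l₄ : ℕ, CubeFull (k₃ * l₄) → k₃ = exactCubePart (k₃ * l₄) →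
        ∀ y : ℝ, 0 ≤ y →
          ∑ m ∈ (intBox n y).filter
              (fun m => MvPolynomial.eval m F₁ = 0 ∧ MvPolynomial.eval m F₂ = 0),
              ‖expSumQ C (appendZero m) (k₃ * l₄)‖
            ≤ K * (((k₃ * l₄ : ℕ) : ℝ) ^ ε *
              ((k₃ : ℝ) ^ ((5 / 6 : ℝ) * n + 4 / 3) * (l₄ : ℝ) ^ (n + 1)
                + y ^ (n - 2) * ((k₃ * l₄ : ℕ) : ℝ) ^ ((1 / 2 : ℝ) * n + 2)))) := by
  refine ⟨?_, fun F₂ hF₂ => ?_⟩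
  -- Codimension one, e = 1: the saving (2 - e)/3 = 1/3 yields the exponent n/2 + 5/3.
  · obtain ⟨c, hc⟩ := exists_card_zeros_le n (map (Int.castRingHom ℚ) F₁) hF₁.1.ne_zero
    obtain ⟨K, hK⟩ := exists_sum_norm_expSumQ_cubeFull_le (by omega) hC hns hε
      (fun x => eval x (map (Int.castRingHom ℚ) F₁) = 0) (c := c) (e := 1) (by norm_num)
      fun T A hA => by
        rw [pow_one]
        convert hc T A hA
    have hexp : (n : ℝ) / 2 + 2 - (2 - (1 : ℕ)) / 3 = 1 / 2 * n + 5 / 3 := by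
      push_cast
      ring
    simp only [eval_intCast_eq_zero_iff, hexp] at hK
    refine ⟨K, fun k₃ l₄ hk hk₃ y hy => ?_⟩
    convert hK k₃ l₄ hk hk₃ y hy
  -- Codimension two, e = 2, by irreducibility of F₁; the exponents of M and R already balance.
  · obtain ⟨c, hc⟩ := exists_card_commonZeros_le n (map (Int.castRingHom ℚ) F₁)
      (map (Int.castRingHom ℚ) F₂) hF₁.1 hF₂
    obtain ⟨K, hK⟩ := exists_sum_norm_expSumQ_cubeFull_le (by omega) hC hns hε
      (fun x => eval x (map (Int.castRingHom ℚ) F₁) = 0 ∧ eval x (map (Int.castRingHom ℚ) F₂) = 0)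
      (c := c) (e := 2) le_rfl
      fun T A hA => by convert hc T A hA
    have hexp : (n : ℝ) / 2 + 2 - (2 - (2 : ℕ)) / 3 = 1 / 2 * n + 2 := by
      push_cast
      ring
    simp only [eval_intCast_eq_zero_iff, hexp] at hK
    refine ⟨K, fun k₃ l₄ hk hk₃ y hy => ?_⟩
    convert hK k₃ l₄ hk hk₃ y hy
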